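/- \textbf{Problem.} Let $M,N\ge 1$ and consider $M$ linear subsystems $x_i(t+1)=A_ix_i(t)+B_iu_i(t)$ with $x_i\in\mathbb R^{n_i}$, $u_i\in\mathbb R^{m_i}$. Assume that each $(A_i,B_i)$ is controllable, and that $\mathcal X_i\subset\mathbb R^{n_i}$ and $\mathcal U_i\subset\mathbb R^{m_i}$ are compact polytopes containing the origin in their interior. Let $Q_i,R_i,P_i$ be positive definite, with $(A_i+B_iK_i)^\top P_i(A_i+B_iK_i)-P_i=-(Q_i+K_i^\top R_iK_i)$, $K_i=-(R_i+B_i^\top P_iB_i)^{-1}B_i^\top P_iA_i$. Let $\Psi_{x_i}\in\mathbb R^{p\times n_i}$, $\Psi_{u_i}\in\mathbb R^{p\times m_i}$, $0\le\varepsilon<\frac1{MN}$. Let the terminal sets $\mathcal X_i^f\subset\mathbb R^{n_i}$ be closed and convex, with $K_iy_i\in\mathcal U_i$, $(A_i+B_iK_i)y_i\in\mathcal X_i^f$ and $\sum_i(\Psi_{x_i}+\Psi_{u_i}K_i)y_i\le(1-\varepsilon MN)\mathbf 1_p$ whenever $y_i\in\mathcal X_i^f$ for all $i$. Fix states $x_i$.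 For an input sequence $\mathbf u_i=(u_i(0),\dots,u_i(N-1))$ put $\tilde x_i(0)=x_i$, $\tilde x_i(\ell+1)=A_i\tilde x_i(\ell)+B_iu_i(\ell)$, and $$J_i(\mathbf u_i)=\sum_{\ell=0}^{N-1}\big(\|\tilde x_i(\ell)\|_{Q_i}^2+\|u_i(\ell)\|_{R_i}^2\big)+\|\tilde x_i(N)\|_{P_i}^2,\qquad \|z\|_Q^2:=z^\top Qz,$$ $$\tilde{\mathcal U}_i=\{\mathbf u_i:\tilde x_i(\ell)\in\mathcal X_i,\ u_i(\ell)\in\mathcal U_i\ (0\le\ell\le N-1),\ \tilde x_i(N)\in\mathcal X_i^f\}.$$ Let $f_i(\mathbf u_i)\in\mathbb R^{Np}$ have blocks $\Psi_{x_i}\tilde x_i(\ell)+\Psi_{u_i}u_i(\ell)$, $0\le\ell\le N-1$, let $b\in\mathbb R^{Np}$ have blocks $(1-\varepsilon M(\ell+1))\mathbf 1_p$, $0\le \ell\le N-1$, and let $g_i=f_i-b/M$. The primal problem is to minimize $\sum_iJ_i(\mathbf u_i)$ subject to $\mathbf u_i\in\tilde{\mathcal U}_i$ and $\sum_if_i(\mathbf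 u_i)\le b$. Its Lagrangian is $\mathcal L(\{\mathbf u_i\},\lambda)=\sum_i\big(J_i(\mathbf u_i)+\lambda^\top g_i(\mathbf u_i)\big)$, and its dual is $\max_{\lambda\in\mathbb R^{Np}_+}\min_{\mathbf u_i\in\tilde{\mathcal U}_i}\mathcal L(\{\mathbf u_i\},\lambda)$. Let $\{\mathbf u_i^*\}$ be a primal optimal solution and $\lambda^*$ a dual optimal solution. \textbf{Network.} Let $L\in\mathbb R^{M\times M}$ be symmetric with $L_{ij}\ge0$ for $j\ne i$, $\mathcal N_i=\{j\ne i:L_{ij}>0\}$, $L_{ii}=-\sum_{j\in\mathcal N_i}L_{ij}$, $\mathbf 1^\top L=0$, $L\mathbf 1=0$, and $\|I+L-\frac{\mathbf 1\mathbf 1^\top}{M}\|<1$ in the spectral norm. \textbf{Algorithm.} Given $\lambda_i^0\in\mathbb R^{Np}_+$, $\mathbf u_i^0\in\tilde{\mathcal U}_i$ and random noises $\zeta_i^k\in\mathbb R^{Np}$, for $k\ge0$ and all $i$ let $$\mathbf u_i^{k+1}=\operatorname*{argmin}_{\mathbf u_i\in\tilde{\mathcal U}_i}\,J_i(\mathbf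 u_i)+(\lambda_i^k)^\top g_i(\mathbf u_i),$$ $$\lambda_i^{k+1}=\Pi_{\mathbb R^{Np}_+}\Big[\lambda_i^k+\chi^k\sum_{j\in\mathcal N_i}L_{ij}(\lambda_j^k+\zeta_j^k-\lambda_i^k)+\gamma^kg_i(\mathbf u_i^{k+1})\Big],$$ where $\Pi$ is the Euclidean projection, and let $\bar\lambda^k=\frac1M\sum_i\lambda_i^k$. \textbf{Noise.} Let $\mathcal F^k$ be the $\sigma$-algebra generated by the $\lambda_j^\ell$, $1\le j\le M$, $0\le\ell\le k$. Assume that $\zeta_i^k$ is square integrable, and that there are deterministic $\sigma_i^k$ with $\mathbb E[\zeta_i^k\mid\mathcal F^k]=0$ and $\mathbb E[\|\zeta_i^k\|^2\mid\mathcal F^k]=(\sigma_i^k)^2$ for all $i,k$, and $\sum_k(\chi^k)^2\max_i(\sigma_i^k)^2<\infty$. \textbf{Theorem.} If the deterministic sequences $\chi^k>0$ and $\gamma^k\ge0$ satisfy $\sum_k\chi^k=\infty$, $\sum_k(\chi^k)^2<\infty$, $\sum_k\gamma^k=\infty$ and $\sum_k\frac{(\gamma^k)^2}{\chi^k}<\infty$,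 then almost surely $$\lim_{k\to\infty}\mathcal L(\{\mathbf u_i^*\},\bar\lambda^k)=\mathcal L(\{\mathbf u_i^*\},\lambda^*)\quad\text{and}\quad\lim_{k\to\infty}\mathcal L(\{\mathbf u_i^k\},\lambda^*)=\mathcal L(\{\mathbf u_i^*\},\lambda^*).$$ -/

import Mathlib

open Filter Topology MeasureTheory ProbabilityTheory
open scoped Matrix

noncomputable section

namespace DMPC

/-- `x` belongs to `argmin_{s} φ`. -/
def IsArgmin {α : Type*} (φ : α → ℝ) (s : Set α) (x : α) : Prop :=
  x ∈ s ∧ IsMinOn φ s x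

/-- `h` is the Euclidean projection of `v` on the set `s`: it minimizes the distance to `v` over
`s`. -/
def IsProjOn {E : Type*} [NormedAddCommGroup E] (s : Set E) (v h : E) : Prop :=
  IsArgmin (fun y => ‖y - v‖) s h

/-- A (bounded and closed) polytope: the convex hull of finitely many points. -/
def IsPolytope {d : ℕ} (S : Set (Fin d → ℝ)) : Prop :=
  ∃ V : Finset (Fin d → ℝ), S = convexHull ℝ (V : Set (Fin d → ℝ))

/-- Controllability of `(A, B)`: the matrix `[B, AB, …, A^{d-1}B]` has full row rank. -/
def IsControllable {d e : ℕ} (A : Matrix (Fin d) (Fin d) ℝ) (B : Matrix (Fin d) (Fin e) ℝ) :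
    Prop :=
  (Matrix.of fun (r : Fin d) (q : Fin d × Fin e) => (A ^ (q.1 : ℕ) * B) r q.2).rank = d

/-- The weighted square `‖x‖²_Q = xᵀ Q x`. -/
def quad {d : ℕ} (Q : Matrix (Fin d) (Fin d) ℝ) (x : Fin d → ℝ) : ℝ :=
  x ⬝ᵥ (Q *ᵥ x)

/-- The Euclidean space `ℝ^{Np}` of multipliers, with coordinates indexed by the prediction step
and the number of the global constraint. -/
abbrev Mult (N p : ℕ) : Type := EuclideanSpace ℝ (Fin N × Fin p)

/-- The non-negative orthant of `ℝ^{Np}`. -/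
def orthant (N p : ℕ) : Set (Mult N p) := {v | ∀ a, 0 ≤ v a}

/-- The data of the distributed model predictive control problem with `M` subsystems, prediction
horizon `N`, `p` global constraints, state dimensions `n i` and input dimensions `m i`. -/
structure Data (M N p : ℕ) (n m : Fin M → ℕ) where
  /-- state matrices -/
  A : ∀ i, Matrix (Fin (n i)) (Fin (n i)) ℝ
  /-- input matrices -/
  B : ∀ i, Matrix (Fin (n i)) (Fin (m i)) ℝ
  /-- state constraint sets -/
  X : ∀ i, Set (Fin (n i) → ℝ)
  /-- input constraint sets -/
  U : ∀ i, Set (Fin (m i) → ℝ)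
  /-- terminal constraint sets -/
  Xf : ∀ i, Set (Fin (n i) → ℝ)
  /-- state weights -/
  Q : ∀ i, Matrix (Fin (n i)) (Fin (n i)) ℝ
  /-- input weights -/
  R : ∀ i, Matrix (Fin (m i)) (Fin (m i)) ℝ
  /-- terminal weights -/
  P : ∀ i, Matrix (Fin (n i)) (Fin (n i)) ℝ
  /-- state matrices of the global constraints -/
  Psix : ∀ i, Matrix (Fin p) (Fin (n i)) ℝ
  /-- input matrices of the global constraints -/
  Psiu : ∀ i, Matrix (Fin p) (Fin (m i)) ℝ
  /-- tolerance parameter -/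
  ε : ℝ

/-- The states of all subsystems. -/
abbrev States {M : ℕ} (n : Fin M → ℕ) : Type := ∀ i, Fin (n i) → ℝ

/-- The input sequences of all subsystems over the horizon. -/
abbrev Inputs {M : ℕ} (N : ℕ) (m : Fin M → ℕ) : Type := ∀ i, Fin N → Fin (m i) → ℝ

namespace Data

variable {M N p : ℕ} {n m : Fin M → ℕ} (D : Data M N p n m)

/-- The feedback gain `K_i = -(R_i + B_iᵀ P_i B_i)⁻¹ B_iᵀ P_i A_i`. -/
def K (i : Fin M) : Matrix (Fin (m i)) (Fin (n i)) ℝ :=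
  -((D.R i + (D.B i)ᵀ * D.P i * D.B i)⁻¹ * (D.B i)ᵀ * D.P i * D.A i)

/-- The predicted states `x̃_i(0), …, x̃_i(N)` from the state `x` under the input sequence `u`. -/
def pred (i : Fin M) (x : Fin (n i) → ℝ) (u : Fin N → Fin (m i) → ℝ) :
    Fin (N + 1) → Fin (n i) → ℝ :=
  fun l => Fin.induction (motive := fun _ => Fin (n i) → ℝ) x
    (fun l y => D.A i *ᵥ y + D.B i *ᵥ u l) l

/-- The local objective `J_i`. -/
def J (i : Fin M) (x : Fin (n i) → ℝ) (u : Fin N → Fin (m i) → ℝ) : ℝ :=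
  (∑ l : Fin N, (quad (D.Q i) (D.pred i x u l.castSucc) + quad (D.R i) (u l)))
    + quad (D.P i) (D.pred i x u (Fin.last N))

/-- The local constraint set `Ũ_i(x)`. -/
def localSet (i : Fin M) (x : Fin (n i) → ℝ) : Set (Fin N → Fin (m i) → ℝ) :=
  {u | (∀ l : Fin N, D.pred i x u l.castSucc ∈ D.X i ∧ u l ∈ D.U i) ∧
    D.pred i x u (Fin.last N) ∈ D.Xf i}

/-- The product of the local constraint sets. -/
def localSets (x : States n) : Set (Inputs N m) := {u | ∀ i, u i ∈ D.localSet i (x i)}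

/-- The coupling function `f_i`. -/
def f (i : Fin M) (x : Fin (n i) → ℝ) (u : Fin N → Fin (m i) → ℝ) : Mult N p :=
  WithLp.toLp 2 fun a => (D.Psix i *ᵥ D.pred i x u a.1.castSucc + D.Psiu i *ᵥ u a.1) a.2

/-- The tightened right-hand side `b(ε)`, with blocks `(1 - εM)𝟏, …, (1 - εMN)𝟏`. -/
def b : Mult N p :=
  WithLp.toLp 2 fun a => 1 - D.ε * (M : ℝ) * (((a.1 : ℕ) : ℝ) + 1)

/-- The function `g_i = f_i - b(ε) / M`. -/
def g (i : Fin M) (x : Fin (n i) → ℝ) (u : Fin N → Fin (m i) → ℝ) : Mult N p :=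
  D.f i x u - (1 / (M : ℝ)) • D.b

/-- The Lagrangian. -/
def lagrangian (x : States n) (u : Inputs N m) (v : Mult N p) : ℝ :=
  (∑ i, D.J i (x i) (u i)) + inner ℝ v ((∑ i, D.f i (x i) (u i)) - D.b)

/-- The feasible set of the primal problem: local constraints and the tightened global
constraints. -/
def feasible (x : States n) : Set (Inputs N m) :=
  {u | u ∈ D.localSets x ∧ ∀ a, (∑ i, D.f i (x i) (u i)) a ≤ D.b a}

/-- `u` solves the primal problem. -/
def IsPrimalOptimal (x : States n) (u : Inputs N m) : Prop :=
  IsArgmin (fun w => ∑ i, D.J i (x i) (w i)) (D.feasible x) u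

/-- The dual function `v ↦ min_u 𝓛(u, v)` over the local constraint sets. -/
def dualFun (x : States n) (v : Mult N p) : ℝ :=
  sInf ((fun u => D.lagrangian x u v) '' D.localSets x)

/-- `v` solves the dual problem `max_{v ≥ 0} min_u 𝓛(u, v)`. -/
def IsDualOptimal (x : States n) (v : Mult N p) : Prop :=
  v ∈ orthant N p ∧ IsMaxOn (D.dualFun x) (orthant N p) v

/-- The standing assumptions on the data. -/
structure Standing : Prop where
  controllable : ∀ i, IsControllable (D.A i) (D.B i)
  polytope_X : ∀ i, IsPolytope (D.X i)
  zero_mem_X : ∀ i, (0 : Fin (n i) → ℝ) ∈ interior (D.X i)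
  polytope_U : ∀ i, IsPolytope (D.U i)
  zero_mem_U : ∀ i, (0 : Fin (m i) → ℝ) ∈ interior (D.U i)
  posDef_Q : ∀ i, (D.Q i).PosDef
  posDef_R : ∀ i, (D.R i).PosDef
  posDef_P : ∀ i, (D.P i).PosDef
  riccati : ∀ i, (D.A i + D.B i * D.K i)ᵀ * D.P i * (D.A i + D.B i * D.K i) - D.P i
    = -(D.Q i + (D.K i)ᵀ * D.R i * D.K i)
  ε_nonneg : 0 ≤ D.ε
  ε_lt : D.ε < 1 / ((M : ℝ) * (N : ℝ))
  closed_Xf : ∀ i, IsClosed (D.Xf i)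
  convex_Xf : ∀ i, Convex ℝ (D.Xf i)
  terminal_input : ∀ i, ∀ y ∈ D.Xf i, D.K i *ᵥ y ∈ D.U i
  terminal_invariant : ∀ i, ∀ y ∈ D.Xf i, (D.A i + D.B i * D.K i) *ᵥ y ∈ D.Xf i
  terminal_global : ∀ y : States n, (∀ i, y i ∈ D.Xf i) →
    ∀ r, (∑ i, (D.Psix i + D.Psiu i * D.K i) *ᵥ y i) r ≤ 1 - D.ε * (M : ℝ) * (N : ℝ)

end Data

/-- The neighbours of subsystem `i`. -/
def neighbors {M : ℕ} (L : Matrix (Fin M) (Fin M) ℝ) (i : Fin M) : Finset (Fin M) :=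
  Finset.univ.filter fun j => j ≠ i ∧ 0 < L i j

/-- The assumptions on the interaction weight matrix; the norm is the spectral norm. -/
structure IsInteraction {M : ℕ} (L : Matrix (Fin M) (Fin M) ℝ) : Prop where
  nonneg : ∀ i j, i ≠ j → 0 ≤ L i j
  diag : ∀ i, L i i = -∑ j ∈ neighbors L i, L i j
  symm : L.IsSymm
  ones_mul : (fun _ => (1 : ℝ)) ᵥ* L = 0
  mul_ones : L *ᵥ (fun _ => (1 : ℝ)) = 0
  norm_lt : ‖Matrix.toEuclideanCLM (𝕜 := ℝ) (n := Fin M)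
    (1 + L - (1 / (M : ℝ)) • Matrix.of fun _ _ => (1 : ℝ))‖ < 1

/-- The sequences `lam` (local multipliers) and `u` (primal iterates) are produced by the
differentially-private distributed dual-gradient algorithm at the state `x`, from the initial
multipliers `lam0`, with weakening factors `χ`, step sizes `γ` and noise realization `ζ`. -/
structure IsExecution {M N p : ℕ} {n m : Fin M → ℕ} (D : Data M N p n m) (x : States n)
    (L : Matrix (Fin M) (Fin M) ℝ) (χ γ : ℕ → ℝ) (lam0 : Fin M → Mult N p)
    (ζ : ℕ → Fin M → Mult N p) (lam : ℕ → Fin M → Mult N p) (u : ℕ → Inputs N m) : Prop where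
  init_lam : lam 0 = lam0
  init_u : u 0 ∈ D.localSets x
  step_u : ∀ k i, IsArgmin (fun w => D.J i (x i) w + inner ℝ (lam k i) (D.g i (x i) w))
    (D.localSet i (x i)) (u (k + 1) i)
  step_lam : ∀ k i, IsProjOn (orthant N p)
    (lam k i + χ k • (∑ j ∈ neighbors L i, L i j • ((lam k j + ζ k j) - lam k i))
      + γ k • D.g i (x i) (u (k + 1) i))
    (lam (k + 1) i)

/-- The σ-algebra generated by the multipliers of all subsystems up to iteration `k`. -/
abbrev history {Ω : Type*} {M N p : ℕ} (lam : ℕ → Fin M → Ω → Mult N p) (k : ℕ) :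
    MeasurableSpace Ω :=
  ⨆ (l : ℕ) (_ : l ≤ k) (j : Fin M), MeasurableSpace.comap (lam l j) inferInstance

/-- The assumptions on the noise: square integrable, with zero conditional mean and deterministic
conditional second moment `(σ_i^k)²` given the history, and `∑ₖ (χ^k)² maxᵢ (σ_i^k)² < ∞`. -/
structure IsNoise {Ω : Type*} [MeasurableSpace Ω] (μ : Measure Ω) {M N p : ℕ} (χ : ℕ → ℝ)
    (σ : ℕ → Fin M → ℝ) (ζ lam : ℕ → Fin M → Ω → Mult N p) : Prop where
  measurable : ∀ k i, Measurable (ζ k i)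
  memLp : ∀ k i, MemLp (ζ k i) 2 μ
  mean : ∀ k i, μ[ζ k i | history lam k] =ᵐ[μ] 0
  second : ∀ k i, μ[fun ω => ‖ζ k i ω‖ ^ 2 | history lam k] =ᵐ[μ] fun _ => σ k i ^ 2
  summable : Summable fun k => χ k ^ 2 * ⨆ i, σ k i ^ 2

/-- The average `λ̄ = (1/M) ∑ᵢ λ_i`. -/
def average {M N p : ℕ} (v : Fin M → Mult N p) : Mult N p :=
  (1 / (M : ℝ)) • ∑ i, v i

end DMPC

end

/-! Each local cost is strongly convex in the inputs, because `R_i` is positive definite and the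
predicted states are affine in the inputs. So the local Lagrangian at a multiplier `v` has a unique
minimizer `R i v` over the compact convex local set, with quadratic growth whose modulus does not
depend on `v`. Comparing the growth inequalities at two multipliers shows that `v ↦ g_i (R i v)` is
monotone with a margin of order `‖R i v - R i v'‖ ^ 2`, and that `R i` is continuous. The algorithm
is thus a noisy, distributed projected ascent along bounded continuous maps.

No constraint qualification is needed: since a dual optimum is given, its first order conditions
already yield feasibility of the responses and complementary slackness, and quadratic growth then
forces the responses to equal the primal optimum (`kkt`).

Convergence uses two Robbins–Siegmund arguments. Mixing contracts the disagreement by a factor `1 -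
cχ`, and Young's inequality absorbs the gradient cross terms at a cost of order `γ²/χ`, which is
summable. Hence the disagreement `E` converges with `∑ χ E < ∞`, and `∑ χ = ∞` forces its limit to
be zero. For a fixed point `s` of the orthant satisfying the optimality conditions, the total
squared distance to `s` converges and `∑ γ G < ∞`, where `G` is the nonnegative optimality residual.
As `∑ γ = ∞`, the residual is small infinitely often, so some cluster point is a zero of `G`;
convergence of the distances to a dense set of zeros upgrades this to convergence of the whole
sequence.

The limit `s` need not be the given dual optimum. Complementary slackness at both makes the two
Lagrangian values agree, and continuity of the responses carries the inputs to the primal optimum.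
-/

namespace DMPC

/-! ### Almost supermartingales and conditionally centred noise -/

section Probability

variable {Ω : Type*} {mΩ : MeasurableSpace Ω} {μ : Measure Ω}

/-- The Robbins-Siegmund theorem for a deterministic summable perturbation. -/
theorem ae_tendsto_and_summable_of_condExp_le [IsProbabilityMeasure μ] (ℱ : Filtration ℕ mΩ)
    {V a : ℕ → Ω → ℝ} {β : ℕ → ℝ} (hV : StronglyAdapted ℱ V) (ha : StronglyAdapted ℱ a)
    (hVi : ∀ k, Integrable (V k) μ) (hV0 : ∀ k ω, 0 ≤ V k ω) (ha0 : ∀ k ω, 0 ≤ a k ω)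
    (hβ0 : ∀ k, 0 ≤ β k) (hβ : Summable β)
    (h : ∀ k, μ[V (k + 1) | ℱ k] ≤ᵐ[μ] fun ω => V k ω - a k ω + β k) :
    ∀ᵐ ω ∂μ, (∃ l, Tendsto (fun k => V k ω) atTop (𝓝 l)) ∧ Summable fun k => a k ω := by
  have hai : ∀ k, Integrable (a k) μ := by
    intro k
    refine Integrable.mono' ((hVi k).add (integrable_const (β k)))
      ((ha k).mono (ℱ.le k)).aestronglyMeasurable ?_
    have h0 : 0 ≤ᵐ[μ] μ[V (k + 1) | ℱ k] := condExp_nonneg (ae_of_all _ (hV0 (k + 1)))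
    filter_upwards [h k, h0] with ω h1 h2
    rw [Real.norm_of_nonneg (ha0 k ω)]
    simp only [Pi.zero_apply, Pi.add_apply] at h2 ⊢
    linarith
  -- Adding the past decreases and subtracting the past perturbations turns `V` into a
  -- supermartingale. The sums stop before `k`, so `A (k + 1)` is already known at time `k`.
  let A : ℕ → Ω → ℝ := fun k ω => ∑ j ∈ Finset.range k, a j ω
  let b : ℕ → ℝ := fun k => ∑ j ∈ Finset.range k, β j
  let X : ℕ → Ω → ℝ := fun k => V k + (A k + fun _ => -b k)
  have hA : ∀ k l, k ≤ l + 1 → StronglyMeasurable[ℱ l] (A k) := fun k l hkl =>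
    Finset.stronglyMeasurable_fun_sum _ fun j hj =>
      (ha j).mono (ℱ.mono (by have := Finset.mem_range.1 hj; omega))
  have hAi : ∀ k, Integrable (A k) μ := fun k => integrable_finsetSum _ fun j _ => hai j
  have hXi : ∀ k, Integrable (X k) μ := fun k => (hVi k).add ((hAi k).add (integrable_const _))
  have hX : Supermartingale X ℱ μ := by
    refine supermartingale_nat (fun k => (hV k).add ((hA k k (by omega)).add
      stronglyMeasurable_const)) hXi fun k => ?_
    have hm : StronglyMeasurable[ℱ k] (A (k + 1) + fun _ => -b (k + 1)) :=
      (hA (k + 1) k le_rfl).add stronglyMeasurable_const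
    have h1 := condExp_add (m := ℱ k) (hVi (k + 1))
      ((hAi (k + 1)).add (integrable_const (-b (k + 1))))
    rw [condExp_of_stronglyMeasurable (ℱ.le k) hm
      ((hAi (k + 1)).add (integrable_const (-b (k + 1))))] at h1
    filter_upwards [h1, h k] with ω h1 h2
    simp only [X]
    rw [h1]
    simp only [Pi.add_apply, A, b, Finset.sum_range_succ]
    linarith
  have hb : ∀ k, b k ≤ ∑' j, β j := fun k => hβ.sum_le_tsum _ fun j _ => hβ0 j
  have hb0 : ∀ k, 0 ≤ b k := fun k => Finset.sum_nonneg fun j _ => hβ0 j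
  have hA0 : ∀ k ω, 0 ≤ A k ω := fun k ω => Finset.sum_nonneg fun j _ => ha0 j ω
  have hint : ∀ k, ∫ ω, X k ω ∂μ ≤ ∫ ω, X 0 ω ∂μ := by
    intro k
    have := hX.setIntegral_le (Nat.zero_le k) MeasurableSet.univ
    simpa using this
  -- Since `X ≥ -∑ β`, one has `|X| ≤ X + 2 ∑ β`, and the mean of `X` does not increase; this gives
  -- the `L¹` bound for the submartingale `-X`.
  have hbdd : ∀ k, eLpNorm ((-X) k) 1 μ
      ≤ (Real.toNNReal ((∫ ω, X 0 ω ∂μ) + 2 * ∑' j, β j) : NNReal) := by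
    intro k
    rw [Pi.neg_apply, eLpNorm_neg, eLpNorm_one_eq_lintegral_enorm,
      ← ofReal_integral_norm_eq_lintegral_enorm (hXi k)]
    refine ENNReal.ofReal_le_ofReal ?_
    calc ∫ ω, ‖X k ω‖ ∂μ ≤ ∫ ω, (X k ω + 2 * ∑' j, β j) ∂μ := by
          refine integral_mono (hXi k).norm ((hXi k).add (integrable_const _)) fun ω => ?_
          have := hV0 k ω
          have := hA0 k ω
          have := hb k
          have := hb0 k
          simp only [X, Pi.add_apply, Real.norm_eq_abs]
          rw [abs_le]
          constructor <;> linarith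
      _ = (∫ ω, X k ω ∂μ) + 2 * ∑' j, β j := by
          rw [integral_add (hXi k) (integrable_const _)]; simp
      _ ≤ _ := by linarith [hint k]
  filter_upwards [hX.neg.exists_ae_tendsto_of_bdd hbdd] with ω hω
  obtain ⟨c, hc⟩ := hω
  have hVA : Tendsto (fun k => V k ω + A k ω) atTop (𝓝 (-c + ∑' j, β j)) := by
    have := hc.neg.add hβ.hasSum.tendsto_sum_nat
    refine this.congr fun k => ?_
    simp only [Pi.neg_apply, X, Pi.add_apply, b]
    ring
  have hs : Summable fun k => a k ω := by
    obtain ⟨B, hB⟩ := hVA.bddAbove_range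
    refine summable_of_sum_range_le (c := B) (fun k => ha0 k ω) fun k => ?_
    have := hB ⟨k, rfl⟩
    have := hV0 k ω
    simp only [A] at *
    linarith
  refine ⟨⟨-c + ∑' j, β j - ∑' j, a j ω, ?_⟩, hs⟩
  refine (hVA.sub hs.hasSum.tendsto_sum_nat).congr fun k => ?_
  simp only [A]
  ring

/-- Adding a conditionally centred noise increases the conditional expectation of the squared norm
by that of the noise. -/
theorem condExp_norm_add_sq {E : Type*} [NormedAddCommGroup E] [InnerProductSpace ℝ E]
    [CompleteSpace E] {m : MeasurableSpace Ω} [IsFiniteMeasure μ] (hm : m ≤ mΩ) {y ξ : Ω → E}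
    (hy : StronglyMeasurable[m] y) (hy2 : MemLp y 2 μ) (hξ : MemLp ξ 2 μ)
    (h0 : μ[ξ | m] =ᵐ[μ] 0) :
    μ[fun ω => ‖y ω + ξ ω‖ ^ 2 | m] =ᵐ[μ] fun ω => ‖y ω‖ ^ 2 + (μ[fun ω => ‖ξ ω‖ ^ 2 | m]) ω := by
  have hyi : Integrable (fun ω => ‖y ω‖ ^ 2) μ := hy2.integrable_norm_pow two_ne_zero
  have hξi : Integrable (fun ω => ‖ξ ω‖ ^ 2) μ := hξ.integrable_norm_pow two_ne_zero
  have hi : Integrable (fun ω => innerSL ℝ (y ω) (ξ ω)) μ := by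
    refine Integrable.mono' (hyi.add hξi) (hy2.1.inner hξ.1) (ae_of_all _ fun ω => ?_)
    have := norm_inner_le_norm (𝕜 := ℝ) (y ω) (ξ ω)
    simp only [innerSL_apply_apply, Pi.add_apply]
    nlinarith [sq_nonneg (‖y ω‖ - ‖ξ ω‖), sq_nonneg ‖y ω‖, sq_nonneg ‖ξ ω‖]
  -- Pulling the known factor `y` out of the cross term leaves the conditional mean of `ξ`, which is
  -- zero.
  have hp := condExp_bilin_of_stronglyMeasurable_left (μ := μ) (m := m) (innerSL ℝ) hy
    hi (hξ.integrable one_le_two)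
  have hsplit : (fun ω => ‖y ω + ξ ω‖ ^ 2) = (fun ω => ‖y ω‖ ^ 2) +
      ((2 : ℝ) • (fun ω => innerSL ℝ (y ω) (ξ ω)) + fun ω => ‖ξ ω‖ ^ 2) := by
    ext ω
    simp only [Pi.add_apply, Pi.smul_apply, smul_eq_mul, innerSL_apply_apply, norm_add_sq_real]
    ring
  have hi' : Integrable ((2 : ℝ) • (fun ω => innerSL ℝ (y ω) (ξ ω))) μ :=
    Integrable.smul (2 : ℝ) hi
  rw [hsplit]
  have hyc : μ[fun ω => ‖y ω‖ ^ 2 | m] = fun ω => ‖y ω‖ ^ 2 :=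
    condExp_of_stronglyMeasurable hm (hy.norm.pow 2) hyi
  filter_upwards [condExp_add hyi (hi'.add hξi) m, condExp_add hi' hξi m,
    condExp_smul (2 : ℝ) (fun ω => innerSL ℝ (y ω) (ξ ω)) m (μ := μ), hp, h0] with ω h1 h2 h3 h4 h5
  rw [h1, Pi.add_apply, h2, Pi.add_apply, h3, Pi.smul_apply, h4, h5, hyc]
  simp

end Probability


/-! ### Mixing contraction and the one-step inequality -/

section Consensus

variable {M N p : ℕ} {L : Matrix (Fin M) (Fin M) ℝ}

/-- The multiplier disagreement vectors of the subsystems. -/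
noncomputable def deviation (v : Fin M → Mult N p) (i : Fin M) : Mult N p := v i - average v

theorem sum_deviation (hM : 0 < M) (v : Fin M → Mult N p) : ∑ i, deviation v i = 0 := by
  have : (M : ℝ) ≠ 0 := by positivity
  simp only [deviation, average, Finset.sum_sub_distrib, Finset.sum_const, Finset.card_univ,
    Fintype.card_fin, ← Nat.cast_smul_eq_nsmul ℝ, smul_smul]
  rw [mul_one_div_cancel this, one_smul, sub_self]

theorem IsInteraction.row_sum (hL : IsInteraction L) (i : Fin M) : ∑ j, L i j = 0 := by
  simpa [Matrix.mulVec, dotProduct] using congrFun hL.mul_ones i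

theorem IsInteraction.col_sum (hL : IsInteraction L) (j : Fin M) : ∑ i, L i j = 0 := by
  simpa [Matrix.vecMul, dotProduct] using congrFun hL.ones_mul j

/-- The averaging matrix kills zero-sum vectors, so on them `I + tL` is the convex combination `(1 -
t) I + t T` with `‖T‖ = ρ`. Its norm is at most `1 - (1 - ρ) t`, a number in `[0, 1]` that dominates
its own square. -/
theorem IsInteraction.sum_sq_le (hL : IsInteraction L) {ρ t : ℝ}
    (hρ : ‖Matrix.toEuclideanCLM (𝕜 := ℝ) (n := Fin M)
      (1 + L - (1 / (M : ℝ)) • Matrix.of fun _ _ => (1 : ℝ))‖ = ρ) (ht : 0 ≤ t) (ht1 : t ≤ 1)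
    (x : Fin M → ℝ) (hx : ∑ i, x i = 0) :
    ∑ i, (x i + t * ∑ j, L i j * x j) ^ 2 ≤ (1 - (1 - ρ) * t) * ∑ i, x i ^ 2 := by
  set T := Matrix.toEuclideanCLM (𝕜 := ℝ) (n := Fin M)
      (1 + L - (1 / (M : ℝ)) • Matrix.of fun _ _ => (1 : ℝ)) with hT
  have hρ0 : 0 ≤ ρ := hρ ▸ norm_nonneg _
  have hρ1 : ρ < 1 := hρ ▸ hL.norm_lt
  let X : EuclideanSpace ℝ (Fin M) := WithLp.toLp 2 x
  have hTX : ∀ i, T X i = x i + ∑ j, L i j * x j := by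
    intro i
    have h1 : T X = WithLp.toLp 2
        ((1 + L - (1 / (M : ℝ)) • Matrix.of fun _ _ => (1 : ℝ)) *ᵥ x) := by
      rw [hT, Matrix.toEuclideanCLM_toLp]
    rw [h1]
    have h2 : ((Matrix.of fun _ _ => (1 : ℝ) : Matrix (Fin M) (Fin M) ℝ) *ᵥ x) i = 0 := by
      simpa [Matrix.mulVec, dotProduct] using hx
    simp only [Matrix.sub_mulVec, Matrix.add_mulVec, Matrix.smul_mulVec, Matrix.one_mulVec,
      Pi.sub_apply, Pi.add_apply, Pi.smul_apply, h2]
    simp [Matrix.mulVec, dotProduct]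
  have hW : ∑ i, (x i + t * ∑ j, L i j * x j) ^ 2 = ‖(1 - t) • X + t • T X‖ ^ 2 := by
    rw [EuclideanSpace.real_norm_sq_eq]
    refine Finset.sum_congr rfl fun i _ => ?_
    simp only [PiLp.add_apply, PiLp.smul_apply, hTX, smul_eq_mul, X]
    ring
  have hX : ∑ i, x i ^ 2 = ‖X‖ ^ 2 := by
    rw [EuclideanSpace.real_norm_sq_eq]
  have hn : ‖(1 - t) • X + t • T X‖ ≤ (1 - (1 - ρ) * t) * ‖X‖ := by
    calc _ ≤ ‖(1 - t) • X‖ + ‖t • T X‖ := norm_add_le _ _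
      _ = (1 - t) * ‖X‖ + t * ‖T X‖ := by
        rw [norm_smul, norm_smul, Real.norm_of_nonneg ht, Real.norm_of_nonneg (by linarith)]
      _ ≤ (1 - t) * ‖X‖ + t * (ρ * ‖X‖) := by
        have := hρ ▸ T.le_opNorm X
        gcongr
      _ = _ := by ring
  have hq0 : 0 ≤ 1 - (1 - ρ) * t := by nlinarith
  have hq1 : 1 - (1 - ρ) * t ≤ 1 := by nlinarith
  rw [hW, hX]
  calc _ ≤ ((1 - (1 - ρ) * t) * ‖X‖) ^ 2 := by gcongr
    _ = (1 - (1 - ρ) * t) * (1 - (1 - ρ) * t) * ‖X‖ ^ 2 := by ring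
    _ ≤ (1 - (1 - ρ) * t) * 1 * ‖X‖ ^ 2 := by gcongr
    _ = _ := by ring

/-- Mixing contracts vectors of zero average. -/
theorem IsInteraction.exists_contraction (hL : IsInteraction L) (N p : ℕ) :
    ∃ c : ℝ, 0 < c ∧ ∀ t : ℝ, 0 ≤ t → t ≤ 1 → ∀ e : Fin M → Mult N p, ∑ i, e i = 0 →
      ∑ i, ‖e i + t • ∑ j, L i j • e j‖ ^ 2 ≤ (1 - c * t) * ∑ i, ‖e i‖ ^ 2 := by
  -- The constant is one minus the spectral norm; the scalar bound is applied in each coordinate of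
  -- the multipliers.
  refine ⟨_, sub_pos.2 hL.norm_lt, fun t ht ht1 e he => ?_⟩
  simp only [EuclideanSpace.real_norm_sq_eq]
  rw [Finset.sum_comm, Finset.sum_comm (f := fun i a => (e i a) ^ 2), Finset.mul_sum]
  refine Finset.sum_le_sum fun a _ => ?_
  have := hL.sum_sq_le rfl ht ht1 (fun i => e i a) (by simpa using congrArg (fun v => v a) he)
  simpa using this

theorem sum_smul_deviation (hL : IsInteraction L) (v : Fin M → Mult N p) (i : Fin M) :
    ∑ j, L i j • deviation v j = ∑ j, L i j • v j := by
  simp [deviation, smul_sub, ← Finset.sum_smul, hL.row_sum i]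

theorem two_mul_mul_le_div {a b ε : ℝ} (hε : 0 < ε) : 2 * (a * b) ≤ ε * a ^ 2 + b ^ 2 / ε := by
  have h : ε * a ^ 2 + b ^ 2 / ε - 2 * (a * b) = (ε * a - b) ^ 2 / ε := by
    field_simp
    ring
  have : 0 ≤ (ε * a - b) ^ 2 / ε := by positivity
  linarith

/-- One noise-free step of mixing and of dual gradient ascent. -/
theorem sum_norm_step_le (hM : 0 < M) (hL : IsInteraction L) {c : ℝ} (hc : 0 < c)
    (hcon : ∀ t : ℝ, 0 ≤ t → t ≤ 1 → ∀ e : Fin M → Mult N p, ∑ i, e i = 0 →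
      ∑ i, ‖e i + t • ∑ j, L i j • e j‖ ^ 2 ≤ (1 - c * t) * ∑ i, ‖e i‖ ^ 2)
    {χ γ B : ℝ} (hχ : 0 < χ) (hχ1 : χ ≤ 1) (hγ : 0 ≤ γ) (v h : Fin M → Mult N p)
    (hB : ∀ i, ‖h i‖ ≤ B) (s : Mult N p) :
    ∑ i, ‖v i + χ • (∑ j, L i j • v j) + γ • h i - s‖ ^ 2 ≤
      ∑ i, ‖v i - s‖ ^ 2 - 3 / 4 * c * χ * ∑ i, ‖deviation v i‖ ^ 2
        + 2 * γ * ∑ i, inner ℝ (v i - s) (h i) + M * (16 / c + 1) * B ^ 2 * (γ ^ 2 / χ) := by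
  set d := average v - s
  set e := deviation v
  set w : Fin M → Mult N p := fun i => e i + χ • ∑ j, L i j • e j
  have he : ∑ i, e i = 0 := sum_deviation hM v
  have hw : ∑ i, w i = 0 := by
    simp only [w, Finset.sum_add_distrib, he, zero_add, ← Finset.smul_sum]
    rw [Finset.sum_comm]
    simp [← Finset.sum_smul, hL.col_sum]
  -- Both `e` and the mixed vector `w` sum to zero, so the cross terms with the common part `d`
  -- vanish after summation.
  have hde : ∑ i, inner ℝ d (e i) = 0 := by rw [← inner_sum, he, inner_zero_right]
  have hdw : ∑ i, inner ℝ d (w i) = 0 := by rw [← inner_sum, hw, inner_zero_right]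
  have hE : ∑ i, ‖w i‖ ^ 2 ≤ (1 - c * χ) * ∑ i, ‖e i‖ ^ 2 := hcon χ hχ.le hχ1 e he
  have hi : ∀ i, ‖v i + χ • (∑ j, L i j • v j) + γ • h i - s‖ ^ 2 ≤ ‖v i - s‖ ^ 2
      - 2 * inner ℝ d (e i) + 2 * inner ℝ d (w i) + (‖w i‖ ^ 2 - ‖e i‖ ^ 2)
      + 2 * γ * inner ℝ (v i - s) (h i) + c * χ / 8 * (‖w i‖ ^ 2 + ‖e i‖ ^ 2)
      + (16 / c + 1) * B ^ 2 * (γ ^ 2 / χ) := by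
    intro i
    have h1 : v i + χ • (∑ j, L i j • v j) + γ • h i - s = (d + w i) + γ • h i := by
      simp only [w, e, sum_smul_deviation hL]
      simp only [d, deviation]
      abel
    have h2 : v i - s = d + e i := by
      simp only [d, e, deviation]
      abel
    rw [h1, h2, norm_add_sq_real (d + w i), norm_add_sq_real d, norm_add_sq_real d, norm_smul,
      real_inner_smul_right, inner_add_left d (w i), inner_add_left d (e i), Real.norm_of_nonneg hγ]
    have h3 : inner ℝ (w i) (h i) ≤ ‖w i‖ * B :=
      (real_inner_le_norm _ _).trans (by gcongr; exact hB i)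
    have h4 : -inner ℝ (e i) (h i) ≤ ‖e i‖ * B := by
      rw [← inner_neg_left, ← norm_neg (e i)]
      exact (real_inner_le_norm _ _).trans (by gcongr; exact hB i)
    -- The Young weight `cχ/8`, used for `w` and for `e`, costs at most `cχ/4` of the contraction
    -- gain `cχ`; this leaves the factor `3/4`. The residual terms add up to `16/c`, and the extra
    -- `1` comes from `γ² ≤ γ²/χ`.
    have hcχ : 0 < c * χ / 8 := by positivity
    have h5 := two_mul_mul_le_div (a := ‖w i‖) (b := γ * B) hcχ
    have h6 := two_mul_mul_le_div (a := ‖e i‖) (b := γ * B) hcχ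
    have h7 : (γ * B) ^ 2 / (c * χ / 8) + (γ * B) ^ 2 / (c * χ / 8)
        = 16 / c * B ^ 2 * (γ ^ 2 / χ) := by
      field_simp
      ring
    have h8 : (γ * ‖h i‖) ^ 2 ≤ B ^ 2 * (γ ^ 2 / χ) := by
      calc (γ * ‖h i‖) ^ 2 ≤ (γ * B) ^ 2 := by
            have := hB i
            gcongr
        _ = B ^ 2 * γ ^ 2 := by ring
        _ ≤ B ^ 2 * (γ ^ 2 / χ) := by
            gcongr
            rw [le_div_iff₀ hχ]
            nlinarith [sq_nonneg γ]
    have h9 := mul_le_mul_of_nonneg_left h3 hγ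
    have h10 := mul_le_mul_of_nonneg_left h4 hγ
    linarith
  refine (Finset.sum_le_sum fun i _ => hi i).trans ?_
  simp only [Finset.sum_add_distrib, Finset.sum_sub_distrib, ← Finset.mul_sum, hde, hdw,
    Finset.sum_const, Finset.card_univ, Fintype.card_fin, nsmul_eq_mul]
  have hE0 : 0 ≤ ∑ i, ‖e i‖ ^ 2 := Finset.sum_nonneg fun i _ => sq_nonneg _
  have hcχ : 0 ≤ c * χ := by positivity
  have := mul_le_mul_of_nonneg_left hE hcχ
  linarith [mul_nonneg (mul_nonneg hcχ hcχ) hE0]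

end Consensus


/-! ### Weighted sums with divergent weights -/

section Sequences

/-- Otherwise `w ≤ (w a) / ε` from some index on, and `w` would be summable. -/
theorem exists_le_lt_of_summable_mul {w a : ℕ → ℝ} (hw : ∀ k, 0 ≤ w k) (ha : ∀ k, 0 ≤ a k)
    (hws : ¬Summable w) (hwa : Summable fun k => w k * a k) {ε : ℝ} (hε : 0 < ε) :
    ∃ᶠ k in atTop, a k < ε := by
  intro hcon
  refine hws ((summable_of_isBigO_nat hwa) ?_)
  refine Asymptotics.IsBigO.of_bound (1 / ε) ?_
  filter_upwards [hcon] with k hk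
  rw [not_lt] at hk
  rw [Real.norm_of_nonneg (hw k), Real.norm_of_nonneg (mul_nonneg (hw k) (ha k)), one_div_mul_eq_div,
    le_div_iff₀ hε]
  exact mul_le_mul_of_nonneg_left hk (hw k)

theorem eq_zero_of_tendsto_of_summable_mul {w a : ℕ → ℝ} (hw : ∀ k, 0 ≤ w k) (ha : ∀ k, 0 ≤ a k)
    (hws : ¬Summable w) (hwa : Summable fun k => w k * a k) {l : ℝ}
    (hl : Tendsto a atTop (𝓝 l)) : l = 0 := by
  by_contra hne
  have hl0 : 0 < l := lt_of_le_of_ne (ge_of_tendsto' hl ha) (Ne.symm hne)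
  exact exists_le_lt_of_summable_mul hw ha hws hwa (half_pos hl0)
    ((hl.eventually_const_lt (half_lt_self hl0)).mono fun k hk => not_lt.2 hk.le)

end Sequences

/-! ### From convergent distances to convergent multipliers -/

section Consensus

variable {M N p : ℕ} {L : Matrix (Fin M) (Fin M) ℝ}

/-- The average minimizes the sum of squared distances. This lets the new disagreement be bounded by
distances to the old average. -/
theorem sum_norm_deviation_sq_le (hM : 0 < M) (v : Fin M → Mult N p) (s : Mult N p) :
    ∑ i, ‖deviation v i‖ ^ 2 ≤ ∑ i, ‖v i - s‖ ^ 2 := by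
  have h : ∀ i, ‖v i - s‖ ^ 2 = ‖deviation v i‖ ^ 2 + 2 * inner ℝ (deviation v i) (average v - s)
      + ‖average v - s‖ ^ 2 := by
    intro i
    rw [← norm_add_sq_real]
    congr 2
    simp only [deviation]
    abel
  simp only [h, Finset.sum_add_distrib, ← Finset.mul_sum, ← sum_inner, sum_deviation hM,
    inner_zero_left]
  have : 0 ≤ ∑ _i : Fin M, ‖average v - s‖ ^ 2 := Finset.sum_nonneg fun i _ => sq_nonneg _
  linarith

/-- Young's inequality spends a further `cχ/4` of the contraction, so that `cχ/2` remains in the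
final recursions. -/
theorem two_mul_sum_norm_le {c χ γ C : ℝ} (hc : 0 < c) (hχ : 0 < χ) (e : Fin M → Mult N p) :
    2 * γ * (C * ∑ i, ‖e i‖) ≤
      c * χ / 4 * ∑ i, ‖e i‖ ^ 2 + M * (4 / c) * C ^ 2 * (γ ^ 2 / χ) := by
  have h : ∀ i, 2 * (‖e i‖ * (γ * C)) ≤ c * χ / 4 * ‖e i‖ ^ 2 + 4 / c * C ^ 2 * (γ ^ 2 / χ) := by
    intro i
    have h1 := two_mul_mul_le_div (a := ‖e i‖) (b := γ * C) (ε := c * χ / 4) (by positivity)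
    have h2 : (γ * C) ^ 2 / (c * χ / 4) = 4 / c * C ^ 2 * (γ ^ 2 / χ) := by
      field_simp
    rwa [h2] at h1
  have h3 := Finset.sum_le_sum fun i (_ : i ∈ Finset.univ) => h i
  simp only [Finset.sum_add_distrib, ← Finset.mul_sum, ← Finset.sum_mul, Finset.sum_const,
    Finset.card_univ, Fintype.card_fin, nsmul_eq_mul] at h3
  linarith

@[fun_prop]
theorem continuous_average : Continuous (average : (Fin M → Mult N p) → Mult N p) := by
  unfold average
  fun_prop

theorem average_const (hM : 0 < M) (s : Mult N p) : average (fun _ : Fin M => s) = s := by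
  have : (M : ℝ) ≠ 0 := by positivity
  simp [average, ← Nat.cast_smul_eq_nsmul ℝ, smul_smul, this]

/-- A bounded sequence whose disagreement vanishes, whose residual `G` is small infinitely often
and whose distances to the zeros of `G` converge, converges to a zero of `G`. -/
theorem exists_tendsto_of_residual (hM : 0 < M) {v : ℕ → Fin M → Mult N p} {K : Set (Mult N p)}
    (hK : IsClosed K) (hv : ∀ k i, v k i ∈ K) {G : (Fin M → Mult N p) → ℝ} (hG : Continuous G)
    (hG0 : ∀ k, 0 ≤ G (v k)) {S : Set (Mult N p)} (hS : S = {s ∈ K | G (fun _ => s) = 0})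
    {d : ℕ → S} (hd : DenseRange d)
    (hdev : Tendsto (fun k => ∑ i, ‖deviation (v k) i‖ ^ 2) atTop (𝓝 0))
    (hfreq : ∀ ε > 0, ∃ᶠ k in atTop, G (v k) < ε)
    (hlim : ∀ n, ∃ l, Tendsto (fun k => ∑ i, ‖v k i - d n‖ ^ 2) atTop (𝓝 l)) :
    ∃ s ∈ S, ∀ i, Tendsto (fun k => v k i) atTop (𝓝 s) := by
  obtain ⟨φ, hφ, hGφ⟩ := extraction_forall_of_frequently
    (fun n : ℕ => hfreq (1 / ((n : ℝ) + 1)) Nat.one_div_pos_of_nat)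
  have hGφ0 : Tendsto (fun n => G (v (φ n))) atTop (𝓝 0) :=
    squeeze_zero (fun n => hG0 _) (fun n => (hGφ n).le) tendsto_one_div_add_atTop_nhds_zero_nat
  have hsingle : ∀ (a : Fin M → ℝ), (∀ i, 0 ≤ a i) → ∀ i, a i ≤ ∑ i, a i := fun a ha i =>
    Finset.single_le_sum (f := a) (fun j _ => ha j) (Finset.mem_univ i)
  have hdevi : ∀ i, Tendsto (fun k => deviation (v k) i) atTop (𝓝 0) := by
    intro i
    rw [tendsto_zero_iff_norm_tendsto_zero]
    have h1 : Tendsto (fun k => ‖deviation (v k) i‖ ^ 2) atTop (𝓝 0) :=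
      squeeze_zero (fun k => sq_nonneg _)
        (fun k => hsingle (fun i => ‖deviation (v k) i‖ ^ 2) (fun i => sq_nonneg _) i) hdev
    have h2 := h1.sqrt
    simpa [Real.sqrt_sq (norm_nonneg _)] using h2
  let i₀ : Fin M := ⟨0, hM⟩
  obtain ⟨l₀, hl₀⟩ := hlim 0
  obtain ⟨C, hC⟩ := hl₀.bddAbove_range
  have hbd : ∀ n, v (φ n) i₀ ∈ Metric.closedBall (d 0 : Mult N p) (Real.sqrt C) := by
    intro n
    rw [mem_closedBall_iff_norm]
    exact Real.le_sqrt_of_sq_le ((hsingle (fun i => ‖v (φ n) i - d 0‖ ^ 2)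
      (fun i => sq_nonneg _) i₀).trans (hC ⟨φ n, rfl⟩))
  obtain ⟨s, -, ψ, hψ, hs⟩ := tendsto_subseq_of_bounded Metric.isBounded_closedBall hbd
  have hθ : Tendsto (φ ∘ ψ) atTop atTop := hφ.tendsto_atTop.comp hψ.tendsto_atTop
  -- Vanishing disagreement drags all subsystems to the cluster point of subsystem `i₀`.
  have hvs : Tendsto (fun n => v (φ (ψ n))) atTop (𝓝 fun _ => s) := by
    rw [tendsto_pi_nhds]
    intro i
    have h1 := hs.add (((hdevi i).sub (hdevi i₀)).comp hθ)
    simp only [sub_self, add_zero] at h1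
    refine h1.congr fun n => ?_
    simp only [deviation, Function.comp_apply]
    abel
  have hsK : s ∈ K := hK.mem_of_tendsto hs (Eventually.of_forall fun n => hv _ _)
  have hsS : s ∈ S := by
    rw [hS]
    exact ⟨hsK, tendsto_nhds_unique ((hG.tendsto _).comp hvs) (hGφ0.comp hψ.tendsto_atTop)⟩
  refine ⟨s, hsS, fun i => ?_⟩
  rw [Metric.tendsto_atTop']
  intro ε hε
  have hM' : (0 : ℝ) < M := by exact_mod_cast hM
  -- Distances converge only for the dense points `d n`, so `s` is replaced by one within `δ`. The
  -- limit of the squared distances is then `M * ‖s - d n‖ ^ 2`, read off along the subsequence.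
  obtain ⟨δ, hδ, hδM⟩ : ∃ δ : ℝ, 0 < δ ∧ M * δ ^ 2 < (ε / 2) ^ 2 ∧ δ < ε / 2 := by
    have hcont : Tendsto (fun δ : ℝ => M * δ ^ 2) (𝓝[>] 0) (𝓝 0) := by
      have : Continuous fun δ : ℝ => M * δ ^ 2 := by fun_prop
      simpa using (this.tendsto 0).mono_left nhdsWithin_le_nhds
    have h1 := hcont.eventually_lt_const (show (0 : ℝ) < (ε / 2) ^ 2 by positivity)
    have h2 : ∀ᶠ δ : ℝ in 𝓝[>] 0, δ < ε / 2 :=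
      nhdsWithin_le_nhds (eventually_lt_nhds (by positivity))
    obtain ⟨δ, h3, h4, h5⟩ := (h1.and (h2.and self_mem_nhdsWithin)).exists
    exact ⟨δ, h5, h3, h4⟩
  obtain ⟨n, hn⟩ := hd.exists_dist_lt ⟨s, hsS⟩ hδ
  rw [Subtype.dist_eq, dist_eq_norm] at hn
  obtain ⟨l, hl⟩ := hlim n
  have hl' : l = M * ‖s - d n‖ ^ 2 := by
    have hc : Continuous fun w : Fin M → Mult N p => ∑ i, ‖w i - d n‖ ^ 2 := by fun_prop
    have h1 := (hc.tendsto _).comp hvs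
    simp only [Finset.sum_const, Finset.card_univ, Fintype.card_fin, nsmul_eq_mul] at h1
    exact tendsto_nhds_unique (hl.comp hθ) h1
  have hll : l < (ε / 2) ^ 2 := by
    rw [hl']
    refine lt_of_le_of_lt ?_ hδM.1
    gcongr
  obtain ⟨k₀, hk₀⟩ := eventually_atTop.1 (hl.eventually_lt_const hll)
  refine ⟨k₀, fun k hk => ?_⟩
  have h1 : ‖v k i - d n‖ < ε / 2 :=
    lt_of_pow_lt_pow_left₀ 2 (by positivity) (lt_of_le_of_lt
      (hsingle (fun i => ‖v k i - d n‖ ^ 2) (fun i => sq_nonneg _) i) (hk₀ k hk.le))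
  calc dist (v k i) s ≤ dist (v k i) (d n) + dist (d n : Mult N p) s := dist_triangle _ _ _
    _ < ε / 2 + ε / 2 := by
      rw [dist_comm (d n : Mult N p) s, dist_eq_norm, dist_eq_norm]
      dsimp only at hn
      linarith
    _ = ε := by ring

end Consensus


theorem stronglyMeasurable_pi_of_forall {Ω : Type*} {mΩ : MeasurableSpace Ω} {M N p : ℕ}
    {v : Fin M → Ω → Mult N p} (hv : ∀ i, StronglyMeasurable (v i)) :
    StronglyMeasurable fun ω i => v i ω :=
  (measurable_pi_lambda _ fun i => (hv i).measurable).stronglyMeasurable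

/-! ### Almost sure convergence of the noisy ascent -/

section Stochastic

variable {M N p : ℕ} {L : Matrix (Fin M) (Fin M) ℝ}
  {Ω : Type*} {mΩ : MeasurableSpace Ω} {μ : Measure Ω} [IsProbabilityMeasure μ]

/-- Centred noise adds only its conditional variance to the noise-free inequality. The reference
point `s` may be random but known, so that it can be the current average as well as a fixed
multiplier. -/
theorem condExp_sum_norm_sq_le (hM : 0 < M) (hL : IsInteraction L) {c : ℝ} (hc : 0 < c)
    (hcon : ∀ t : ℝ, 0 ≤ t → t ≤ 1 → ∀ e : Fin M → Mult N p, ∑ i, e i = 0 →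
      ∑ i, ‖e i + t • ∑ j, L i j • e j‖ ^ 2 ≤ (1 - c * t) * ∑ i, ‖e i‖ ^ 2)
    {m : MeasurableSpace Ω} (hm : m ≤ mΩ) {χ γ B τ : ℝ} (hχ : 0 < χ) (hχ1 : χ ≤ 1) (hγ : 0 ≤ γ)
    {h : Fin M → Mult N p → Mult N p} (hh : ∀ i, Continuous (h i)) (hB : ∀ i v, ‖h i v‖ ≤ B)
    {v v' η : Fin M → Ω → Mult N p} {s : Ω → Mult N p} (hv : ∀ i, StronglyMeasurable[m] (v i))
    (hs : StronglyMeasurable[m] s) (hv2 : ∀ i, MemLp (v i) 2 μ) (hv2' : ∀ i, MemLp (v' i) 2 μ)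
    (hη2 : ∀ i, MemLp (η i) 2 μ) (hs2 : MemLp s 2 μ) (hη0 : ∀ i, μ[η i | m] =ᵐ[μ] 0)
    (hητ : ∀ i, μ[fun ω => ‖η i ω‖ ^ 2 | m] ≤ᵐ[μ] fun _ => τ)
    (hstep : ∀ ω i, ‖v' i ω - s ω‖
      ≤ ‖v i ω + χ • (∑ j, L i j • v j ω) + γ • h i (v i ω) + η i ω - s ω‖) :
    μ[fun ω => ∑ i, ‖v' i ω - s ω‖ ^ 2 | m] ≤ᵐ[μ] fun ω =>
      ∑ i, ‖v i ω - s ω‖ ^ 2 - 3 / 4 * c * χ * ∑ i, ‖deviation (fun i => v i ω) i‖ ^ 2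
        + 2 * γ * ∑ i, inner ℝ (v i ω - s ω) (h i (v i ω))
        + M * (16 / c + 1) * B ^ 2 * (γ ^ 2 / χ) + M * τ := by
  let y : Fin M → Ω → Mult N p := fun i ω =>
    v i ω + χ • (∑ j, L i j • v j ω) + γ • h i (v i ω) - s ω
  have hhv : ∀ i, StronglyMeasurable[m] fun ω => h i (v i ω) := fun i =>
    (hh i).comp_stronglyMeasurable (hv i)
  have hy : ∀ i, StronglyMeasurable[m] (y i) := fun i =>
    (((hv i).add ((Finset.stronglyMeasurable_fun_sum _ fun j _ =>
      (hv j).const_smul (L i j)).const_smul χ)).add ((hhv i).const_smul γ)).sub hs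
  have hhv2 : ∀ i, MemLp (fun ω => h i (v i ω)) 2 μ := fun i =>
    MemLp.of_bound ((hhv i).mono hm).aestronglyMeasurable B (ae_of_all _ fun ω => hB i _)
  have hy2 : ∀ i, MemLp (y i) 2 μ := fun i =>
    (((hv2 i).add ((memLp_finsetSum _ fun j _ =>
      (hv2 j).const_smul (L i j)).const_smul χ)).add ((hhv2 i).const_smul γ)).sub hs2
  have hyη : ∀ i, Integrable (fun ω => ‖y i ω + η i ω‖ ^ 2) μ := fun i =>
    ((hy2 i).add (hη2 i)).integrable_norm_pow two_ne_zero
  have hsum := condExp_finsetSum (μ := μ) (s := Finset.univ)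
    (f := fun i ω => ‖y i ω + η i ω‖ ^ 2) (fun i _ => hyη i) m
  have hle : μ[fun ω => ∑ i, ‖v' i ω - s ω‖ ^ 2 | m]
      ≤ᵐ[μ] μ[∑ i, fun ω => ‖y i ω + η i ω‖ ^ 2 | m] := by
    refine condExp_mono (integrable_finsetSum _ fun i _ =>
      ((hv2' i).sub hs2).integrable_norm_pow two_ne_zero)
      (integrable_finsetSum' _ fun i _ => hyη i) (ae_of_all _ fun ω => ?_)
    simp only [Finset.sum_apply]
    refine Finset.sum_le_sum fun i _ => ?_
    have h1 := hstep ω i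
    have h2 : v i ω + χ • (∑ j, L i j • v j ω) + γ • h i (v i ω) + η i ω - s ω
        = y i ω + η i ω := by
      simp only [y]
      abel
    rw [h2] at h1
    gcongr
  have hall : ∀ᵐ ω ∂μ, ∀ i, (μ[fun ω => ‖y i ω + η i ω‖ ^ 2 | m]) ω ≤ ‖y i ω‖ ^ 2 + τ := by
    rw [ae_all_iff]
    intro i
    filter_upwards [condExp_norm_add_sq hm (hy i) (hy2 i) (hη2 i) (hη0 i), hητ i] with ω h1 h2
    rw [h1]
    linarith
  filter_upwards [hsum, hle, hall] with ω h1 h2 h3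
  refine h2.trans ?_
  rw [h1, Finset.sum_apply]
  refine (Finset.sum_le_sum fun i _ => h3 i).trans ?_
  rw [Finset.sum_add_distrib]
  simp only [Finset.sum_const, Finset.card_univ, Fintype.card_fin, nsmul_eq_mul]
  have := sum_norm_step_le hM hL hc hcon hχ hχ1 hγ (fun i => v i ω) (fun i => h i (v i ω))
    (fun i => hB i _) (s ω)
  simp only [y]
  linarith

/-- Almost sure convergence of distributed projected dual ascent with noisy communication. The
residual `G` vanishes exactly on the constant families of dual optimal multipliers. -/
theorem ae_exists_tendsto_of_step (hM : 0 < M) (hL : IsInteraction L) (ℱ : Filtration ℕ mΩ)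
    {χ γ τ : ℕ → ℝ} (hχ : ∀ k, 0 < χ k) (hχ1 : ∀ k, χ k ≤ 1) (hγ : ∀ k, 0 ≤ γ k)
    (hτ : ∀ k, 0 ≤ τ k) (hχs : ¬Summable χ) (hγs : ¬Summable γ)
    (hγχ : Summable fun k => γ k ^ 2 / χ k) (hτs : Summable τ)
    {h : Fin M → Mult N p → Mult N p} {B : ℝ} (hh : ∀ i, Continuous (h i))
    (hB : ∀ i v, ‖h i v‖ ≤ B) {K : Set (Mult N p)} (hK : IsClosed K) (hKc : Convex ℝ K)
    {v η : ℕ → Fin M → Ω → Mult N p} (hv : ∀ k i, StronglyMeasurable[ℱ k] (v k i))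
    (hv2 : ∀ k i, MemLp (v k i) 2 μ) (hvK : ∀ k i ω, v k i ω ∈ K)
    (hη2 : ∀ k i, MemLp (η k i) 2 μ) (hη0 : ∀ k i, μ[η k i | ℱ k] =ᵐ[μ] 0)
    (hητ : ∀ k i, μ[fun ω => ‖η k i ω‖ ^ 2 | ℱ k] ≤ᵐ[μ] fun _ => τ k)
    (hstep : ∀ k ω i, ∀ s ∈ K, ‖v (k + 1) i ω - s‖ ≤
      ‖v k i ω + χ k • (∑ j, L i j • v k j ω) + γ k • h i (v k i ω) + η k i ω - s‖)
    {G : (Fin M → Mult N p) → ℝ} {C : ℝ} (hG : Continuous G)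
    (hG0 : ∀ w, (∀ i, w i ∈ K) → 0 ≤ G w) (hGz : ∃ s ∈ K, G (fun _ => s) = 0)
    (hGh : ∀ s ∈ K, G (fun _ => s) = 0 → ∀ w, (∀ i, w i ∈ K) →
      ∑ i, inner ℝ (w i - s) (h i (w i)) ≤ -G w + C * ∑ i, ‖deviation w i‖) :
    ∀ᵐ ω ∂μ, ∃ s ∈ K, G (fun _ => s) = 0 ∧
      ∀ i, Tendsto (fun k => v k i ω) atTop (𝓝 s) := by
  obtain ⟨c, hc, hcon⟩ := hL.exists_contraction N p
  have hvpi : ∀ k, StronglyMeasurable[ℱ k] fun ω i => v k i ω := fun k =>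
    stronglyMeasurable_pi_of_forall (hv k)
  let E : ℕ → Ω → ℝ := fun k ω => ∑ i, ‖deviation (fun i => v k i ω) i‖ ^ 2
  let avg : ℕ → Ω → Mult N p := fun k ω => average fun i => v k i ω
  have havg : ∀ k, StronglyMeasurable[ℱ k] (avg k) := fun k =>
    continuous_average.comp_stronglyMeasurable (hvpi k)
  have havg2 : ∀ k, MemLp (avg k) 2 μ := fun k =>
    MemLp.const_smul (f := fun ω => ∑ i, v k i ω) (memLp_finsetSum _ fun i _ => hv2 k i)
      (1 / (M : ℝ))
  have havgK : ∀ k ω, avg k ω ∈ K := by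
    intro k ω
    simp only [avg, average, Finset.smul_sum]
    refine hKc.sum_mem (fun i _ => by positivity) ?_ fun i _ => hvK k i ω
    have : (M : ℝ) ≠ 0 := by positivity
    simp [this]
  have hE : StronglyAdapted ℱ E := fun k =>
    Finset.stronglyMeasurable_fun_sum _ fun i _ => ((hv k i).sub (havg k)).norm.pow 2
  have hEi : ∀ k, Integrable (E k) μ := fun k => integrable_finsetSum _ fun i _ =>
    ((hv2 k i).sub (havg2 k)).integrable_norm_pow two_ne_zero
  have hE0 : ∀ k ω, 0 ≤ E k ω := fun k ω => Finset.sum_nonneg fun i _ => sq_nonneg _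
  have hβs : ∀ κ : ℝ, Summable fun k => κ * (γ k ^ 2 / χ k) + M * τ k := fun κ =>
    (hγχ.mul_left κ).add (hτs.mul_left _)
  have hγχ0 : ∀ k, 0 ≤ γ k ^ 2 / χ k := fun k => by
    have := hχ k
    positivity
  have hβ0 : ∀ κ : ℝ, 0 ≤ κ → ∀ k, 0 ≤ κ * (γ k ^ 2 / χ k) + M * τ k := fun κ hκ k => by
    have := hγχ0 k
    have := hτ k
    positivity
  -- First recursion: the reference point is the current average, and the gradients enter only
  -- through their bound `B`.
  have hdev : ∀ᵐ ω ∂μ, (∃ l, Tendsto (fun k => E k ω) atTop (𝓝 l)) ∧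
      Summable fun k => c / 2 * χ k * E k ω := by
    refine ae_tendsto_and_summable_of_condExp_le ℱ hE (fun k => (hE k).const_mul _) hEi hE0
      (fun k ω => ?_) (hβ0 (M * (16 / c + 1) * B ^ 2 + M * (4 / c) * B ^ 2) (by positivity))
      (hβs _) fun k => ?_
    · have := hχ k
      have := hE0 k ω
      positivity
    · have h1 := condExp_sum_norm_sq_le hM hL hc hcon (ℱ.le k) (hχ k) (hχ1 k) (hγ k) hh hB
        (hv k) (havg k) (hv2 k) (hv2 (k + 1)) (hη2 k) (havg2 k) (hη0 k) (hητ k)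
        (fun ω i => hstep k ω i _ (havgK k ω))
      have h2 : μ[E (k + 1) | ℱ k] ≤ᵐ[μ]
          μ[fun ω => ∑ i, ‖v (k + 1) i ω - avg k ω‖ ^ 2 | ℱ k] :=
        condExp_mono (hEi (k + 1)) (integrable_finsetSum _ fun i _ =>
          ((hv2 (k + 1) i).sub (havg2 k)).integrable_norm_pow two_ne_zero)
          (ae_of_all _ fun ω => sum_norm_deviation_sq_le hM _ _)
      filter_upwards [h1, h2] with ω h1 h2
      refine (h2.trans h1).trans ?_
      have h3 : ∑ i, inner ℝ (v k i ω - avg k ω) (h i (v k i ω))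
          ≤ B * ∑ i, ‖deviation (fun i => v k i ω) i‖ := by
        rw [Finset.mul_sum]
        refine Finset.sum_le_sum fun i _ => (real_inner_le_norm _ _).trans ?_
        rw [mul_comm]
        exact mul_le_mul_of_nonneg_right (hB i _) (norm_nonneg _)
      have h4 := mul_le_mul_of_nonneg_left h3 (mul_nonneg zero_le_two (hγ k))
      have h5 := two_mul_sum_norm_le (γ := γ k) (C := B) hc (hχ k)
        (deviation fun i => v k i ω)
      have h6 : ∑ i, ‖v k i ω - avg k ω‖ ^ 2 = E k ω := rfl
      rw [h6]
      simp only [E] at *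
      linarith
  let S : Set (Mult N p) := {s ∈ K | G (fun _ => s) = 0}
  have hSne : Nonempty S := by
    obtain ⟨s, hs, hs'⟩ := hGz
    exact ⟨⟨s, hs, hs'⟩⟩
  have hGv : ∀ k, StronglyMeasurable[ℱ k] fun ω => G fun i => v k i ω := fun k =>
    hG.comp_stronglyMeasurable (hvpi k)
  -- Second recursion: the reference point is a zero of `G`, and `hGh` turns the gradient term into
  -- a decrease `2γG` up to disagreement.
  have hfejer : ∀ s : S, ∀ᵐ ω ∂μ,
      (∃ l, Tendsto (fun k => ∑ i, ‖v k i ω - s‖ ^ 2) atTop (𝓝 l)) ∧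
      Summable fun k => c / 2 * χ k * E k ω + 2 * γ k * G fun i => v k i ω := by
    intro s
    have hs2 : MemLp (fun _ : Ω => (s : Mult N p)) 2 μ := memLp_const _
    refine ae_tendsto_and_summable_of_condExp_le ℱ
      (V := fun k ω => ∑ i, ‖v k i ω - s‖ ^ 2)
      (a := fun k ω => c / 2 * χ k * E k ω + 2 * γ k * G fun i => v k i ω)
      (fun k => Finset.stronglyMeasurable_fun_sum _ fun i _ =>
        ((hv k i).sub stronglyMeasurable_const).norm.pow 2)
      (fun k => ((hE k).const_mul _).add ((hGv k).const_mul _))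
      (fun k => integrable_finsetSum _ fun i _ =>
        ((hv2 k i).sub hs2).integrable_norm_pow two_ne_zero)
      (fun k ω => Finset.sum_nonneg fun i _ => sq_nonneg _)
      (fun k ω => ?_) (hβ0 (M * (16 / c + 1) * B ^ 2 + M * (4 / c) * C ^ 2) (by positivity))
      (hβs _) fun k => ?_
    · have := hχ k
      have := hE0 k ω
      have := hγ k
      have := hG0 (fun i => v k i ω) fun i => hvK k i ω
      positivity
    · have h1 := condExp_sum_norm_sq_le hM hL hc hcon (ℱ.le k) (hχ k) (hχ1 k) (hγ k) hh hB
        (hv k) stronglyMeasurable_const (hv2 k) (hv2 (k + 1)) (hη2 k) hs2 (hη0 k) (hητ k)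
        (fun ω i => hstep k ω i _ s.2.1)
      filter_upwards [h1] with ω h1
      refine h1.trans ?_
      have h3 := hGh s s.2.1 s.2.2 (fun i => v k i ω) fun i => hvK k i ω
      have h4 := mul_le_mul_of_nonneg_left h3 (mul_nonneg zero_le_two (hγ k))
      have h5 := two_mul_sum_norm_le (γ := γ k) (C := C) hc (hχ k)
        (deviation fun i => v k i ω)
      simp only [E] at *
      linarith
  -- The exceptional null set depends on `s`; a countable dense family gives a single one.
  obtain ⟨d, hd⟩ := TopologicalSpace.exists_dense_seq S
  have hfejer' := ae_all_iff.2 fun n => hfejer (d n)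
  filter_upwards [hdev, hfejer'] with ω ⟨⟨l, hl⟩, hsum⟩ hω
  have hsum' : Summable fun k => χ k * E k ω := by
    refine (hsum.mul_left (2 / c)).congr fun k => ?_
    field_simp
  have hl0 : l = 0 := eq_zero_of_tendsto_of_summable_mul (fun k => (hχ k).le) (fun k => hE0 k ω)
    hχs hsum' hl
  have hGω : ∀ k, 0 ≤ G fun i => v k i ω := fun k => hG0 _ fun i => hvK k i ω
  have hGsum : Summable fun k => γ k * G fun i => v k i ω := by
    refine (((hω 0).2.sub hsum).mul_left (1 / 2)).congr fun k => ?_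
    ring
  obtain ⟨s, hs, hlim⟩ := exists_tendsto_of_residual hM hK (fun k i => hvK k i ω) hG hGω
    (S := S) rfl hd (hl0 ▸ hl)
    (fun ε hε => exists_le_lt_of_summable_mul hγ hGω hγs hGsum hε) (fun n => (hω n).1)
  exact ⟨s, hs.1, hs.2, hlim⟩

/-- `ae_exists_tendsto_of_step` when the mixing weights are at most one from some time on. -/
theorem ae_exists_tendsto_of_step_shift (hM : 0 < M) (hL : IsInteraction L) (ℱ : Filtration ℕ mΩ)
    {χ γ τ : ℕ → ℝ} {k₀ : ℕ} (hχ : ∀ k, 0 < χ k) (hχ1 : ∀ k, k₀ ≤ k → χ k ≤ 1)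
    (hγ : ∀ k, 0 ≤ γ k)
    (hτ : ∀ k, 0 ≤ τ k) (hχs : ¬Summable χ) (hγs : ¬Summable γ)
    (hγχ : Summable fun k => γ k ^ 2 / χ k) (hτs : Summable τ)
    {h : Fin M → Mult N p → Mult N p} {B : ℝ} (hh : ∀ i, Continuous (h i))
    (hB : ∀ i v, ‖h i v‖ ≤ B) {K : Set (Mult N p)} (hK : IsClosed K) (hKc : Convex ℝ K)
    {v η : ℕ → Fin M → Ω → Mult N p} (hv : ∀ k i, StronglyMeasurable[ℱ k] (v k i))
    (hv2 : ∀ k i, MemLp (v k i) 2 μ) (hvK : ∀ k i ω, v k i ω ∈ K)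
    (hη2 : ∀ k i, MemLp (η k i) 2 μ) (hη0 : ∀ k i, μ[η k i | ℱ k] =ᵐ[μ] 0)
    (hητ : ∀ k i, μ[fun ω => ‖η k i ω‖ ^ 2 | ℱ k] ≤ᵐ[μ] fun _ => τ k)
    (hstep : ∀ k ω i, ∀ s ∈ K, ‖v (k + 1) i ω - s‖ ≤
      ‖v k i ω + χ k • (∑ j, L i j • v k j ω) + γ k • h i (v k i ω) + η k i ω - s‖)
    {G : (Fin M → Mult N p) → ℝ} {C : ℝ} (hG : Continuous G)
    (hG0 : ∀ w, (∀ i, w i ∈ K) → 0 ≤ G w) (hGz : ∃ s ∈ K, G (fun _ => s) = 0)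
    (hGh : ∀ s ∈ K, G (fun _ => s) = 0 → ∀ w, (∀ i, w i ∈ K) →
      ∑ i, inner ℝ (w i - s) (h i (w i)) ≤ -G w + C * ∑ i, ‖deviation w i‖) :
    ∀ᵐ ω ∂μ, ∃ s ∈ K, G (fun _ => s) = 0 ∧
      ∀ i, Tendsto (fun k => v k i ω) atTop (𝓝 s) := by
  let ℱ' : Filtration ℕ mΩ :=
    { seq := fun k => ℱ (k + k₀)
      mono' := fun _ _ h => ℱ.mono (Nat.add_le_add_right h k₀)
      le' := fun k => ℱ.le (k + k₀) }
  have h := ae_exists_tendsto_of_step (μ := μ) hM hL ℱ' (χ := fun k => χ (k + k₀))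
    (γ := fun k => γ (k + k₀)) (τ := fun k => τ (k + k₀)) (fun k => hχ _)
    (fun k => hχ1 _ (Nat.le_add_left _ _)) (fun k => hγ _) (fun k => hτ _)
    (by rwa [summable_nat_add_iff k₀ (f := χ)]) (by rwa [summable_nat_add_iff k₀ (f := γ)])
    ((summable_nat_add_iff k₀).2 hγχ) ((summable_nat_add_iff k₀).2 hτs) hh hB hK hKc
    (v := fun k => v (k + k₀)) (η := fun k => η (k + k₀)) (fun k => hv _) (fun k => hv2 _)
    (fun k => hvK _) (fun k => hη2 _) (fun k => hη0 _) (fun k => hητ _)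
    (fun k ω i s hs => by
      rw [Nat.add_right_comm]
      exact hstep _ ω i s hs)
    hG hG0 hGz hGh
  filter_upwards [h] with ω ⟨s, hs, hz, hlim⟩
  exact ⟨s, hs, hz, fun i => (tendsto_add_atTop_iff_nat k₀).1 (hlim i)⟩

end Stochastic


/-! ### Quadratic forms -/

section QuadraticForms

variable {d : ℕ}

theorem continuous_quad (Q : Matrix (Fin d) (Fin d) ℝ) : Continuous (quad Q) := by
  unfold quad
  fun_prop

theorem quad_smul (Q : Matrix (Fin d) (Fin d) ℝ) (t : ℝ) (x : Fin d → ℝ) :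
    quad Q (t • x) = t ^ 2 * quad Q x := by
  simp only [quad, Matrix.mulVec_smul, smul_dotProduct, dotProduct_smul, smul_eq_mul]
  ring

theorem quad_midpoint (Q : Matrix (Fin d) (Fin d) ℝ) (x y : Fin d → ℝ) :
    quad Q ((1 / 2 : ℝ) • x + (1 / 2 : ℝ) • y)
      = 1 / 2 * quad Q x + 1 / 2 * quad Q y - 1 / 4 * quad Q (x - y) := by
  simp only [quad, Matrix.mulVec_add, Matrix.mulVec_sub, Matrix.mulVec_smul, add_dotProduct,
    sub_dotProduct, dotProduct_add, dotProduct_sub, smul_dotProduct, dotProduct_smul, smul_eq_mul]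
  ring

theorem quad_pos {Q : Matrix (Fin d) (Fin d) ℝ} (hQ : Q.PosDef) {x : Fin d → ℝ} (hx : x ≠ 0) :
    0 < quad Q x := by
  simpa [quad] using hQ.dotProduct_mulVec_pos hx

theorem quad_nonneg {Q : Matrix (Fin d) (Fin d) ℝ} (hQ : Q.PosDef) (x : Fin d → ℝ) :
    0 ≤ quad Q x := by
  simpa [quad] using hQ.posSemidef.dotProduct_mulVec_nonneg x

/-- The constant is the minimum of the form on the unit sphere; in dimension zero the sphere is
empty and any constant works. -/
theorem exists_mul_norm_sq_le_quad {Q : Matrix (Fin d) (Fin d) ℝ} (hQ : Q.PosDef) :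
    ∃ r : ℝ, 0 < r ∧ ∀ x, r * ‖x‖ ^ 2 ≤ quad Q x := by
  rcases (Metric.sphere (0 : Fin d → ℝ) 1).eq_empty_or_nonempty with he | hne
  · refine ⟨1, one_pos, fun x => ?_⟩
    have hx : x = 0 := by
      by_contra hx
      have : (‖x‖⁻¹ • x) ∈ Metric.sphere (0 : Fin d → ℝ) 1 := by
        simp [norm_smul, norm_ne_zero_iff.2 hx]
      simp [he] at this
    simp [hx, quad]
  · obtain ⟨y, hy, hmin⟩ := (isCompact_sphere (0 : Fin d → ℝ) 1).exists_isMinOn hne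
      (continuous_quad Q).continuousOn
    have hy0 : y ≠ 0 := ne_zero_of_mem_unit_sphere ⟨y, hy⟩
    refine ⟨quad Q y, quad_pos hQ hy0, fun x => ?_⟩
    by_cases hx : x = 0
    · simp [hx, quad]
    · have hx' : ‖x‖ ≠ 0 := norm_ne_zero_iff.2 hx
      have h1 : quad Q y ≤ quad Q (‖x‖⁻¹ • x) := hmin (by simp [norm_smul, hx'])
      calc quad Q y * ‖x‖ ^ 2 ≤ quad Q (‖x‖⁻¹ • x) * ‖x‖ ^ 2 := by gcongr
        _ = quad Q x := by
          rw [quad_smul]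
          field_simp

end QuadraticForms

/-! ### Strong convexity and compactness of the local problems -/

namespace Data

variable {M N p : ℕ} {n m : Fin M → ℕ} (D : Data M N p n m)

theorem pred_zero (i : Fin M) (x : Fin (n i) → ℝ) (u : Fin N → Fin (m i) → ℝ) :
    D.pred i x u 0 = x := rfl

theorem pred_succ (i : Fin M) (x : Fin (n i) → ℝ) (u : Fin N → Fin (m i) → ℝ) (l : Fin N) :
    D.pred i x u l.succ = D.A i *ᵥ D.pred i x u l.castSucc + D.B i *ᵥ u l := by
  simp [pred]

theorem pred_affine (i : Fin M) (x : Fin (n i) → ℝ) (u w : Fin N → Fin (m i) → ℝ) {a b : ℝ}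
    (hab : a + b = 1) (l : Fin (N + 1)) :
    D.pred i x (a • u + b • w) l = a • D.pred i x u l + b • D.pred i x w l := by
  induction l using Fin.induction with
  | zero => simp only [pred_zero, ← add_smul, hab, one_smul]
  | succ l ih =>
    simp only [pred_succ, ih, Pi.add_apply, Pi.smul_apply, Matrix.mulVec_add, Matrix.mulVec_smul,
      smul_add]
    abel

theorem continuous_pred (i : Fin M) (x : Fin (n i) → ℝ) (l : Fin (N + 1)) :
    Continuous fun u => D.pred i x u l := by
  induction l using Fin.induction with
  | zero => exact continuous_const
  | succ l ih =>
    simp only [pred_succ]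
    fun_prop

theorem continuous_J (i : Fin M) (x : Fin (n i) → ℝ) : Continuous (D.J i x) := by
  have hq := fun l => D.continuous_pred i x l
  refine (continuous_finsetSum _ fun l _ => ((continuous_quad _).comp (hq _)).add
    ((continuous_quad _).comp (continuous_apply l))).add ((continuous_quad _).comp (hq _))

theorem continuous_f (i : Fin M) (x : Fin (n i) → ℝ) : Continuous (D.f i x) := by
  have hq := fun l => D.continuous_pred i x l
  unfold f
  fun_prop

theorem continuous_g (i : Fin M) (x : Fin (n i) → ℝ) : Continuous (D.g i x) :=
  (D.continuous_f i x).sub continuous_const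

theorem f_affine (i : Fin M) (x : Fin (n i) → ℝ) (u w : Fin N → Fin (m i) → ℝ) {a b : ℝ}
    (hab : a + b = 1) : D.f i x (a • u + b • w) = a • D.f i x u + b • D.f i x w := by
  ext c
  simp only [f, D.pred_affine i x u w hab, Matrix.mulVec_add, Matrix.mulVec_smul, Pi.add_apply,
    Pi.smul_apply, smul_eq_mul, PiLp.add_apply, PiLp.smul_apply]
  ring

theorem g_affine (i : Fin M) (x : Fin (n i) → ℝ) (u w : Fin N → Fin (m i) → ℝ) {a b : ℝ}
    (hab : a + b = 1) : D.g i x (a • u + b • w) = a • D.g i x u + b • D.g i x w := by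
  simp only [g, D.f_affine i x u w hab, smul_sub]
  set c := (1 / (M : ℝ)) • D.b
  have h : c = a • c + b • c := by rw [← add_smul, hab, one_smul]
  conv_lhs => rw [h]
  abel

variable {D}

/-- Predictions at a midpoint are midpoints of predictions. The state and terminal defects are
nonnegative and dropped; the input defect carries the strong convexity. -/
theorem J_midpoint_le (hD : D.Standing) (i : Fin M) (x : Fin (n i) → ℝ)
    (u w : Fin N → Fin (m i) → ℝ) :
    D.J i x ((1 / 2 : ℝ) • u + (1 / 2 : ℝ) • w) ≤ 1 / 2 * D.J i x u + 1 / 2 * D.J i x w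
      - 1 / 4 * ∑ l, quad (D.R i) (u l - w l) := by
  simp only [J, D.pred_affine i x u w (show (1 / 2 : ℝ) + 1 / 2 = 1 by norm_num), quad_midpoint,
    Pi.add_apply, Pi.smul_apply, Finset.sum_add_distrib, Finset.sum_sub_distrib, ← Finset.mul_sum]
  have h1 := quad_nonneg (hD.posDef_P i) (D.pred i x u (Fin.last N) - D.pred i x w (Fin.last N))
  have h2 : 0 ≤ ∑ l : Fin N, quad (D.Q i) (D.pred i x u l.castSucc - D.pred i x w l.castSucc) :=
    Finset.sum_nonneg fun l _ => quad_nonneg (hD.posDef_Q i) _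
  linarith

theorem IsPolytope.isCompact {d : ℕ} {S : Set (Fin d → ℝ)} (hS : IsPolytope S) :
    IsCompact S ∧ Convex ℝ S := by
  obtain ⟨V, rfl⟩ := hS
  exact ⟨V.finite_toSet.isCompact_convexHull ℝ, convex_convexHull ℝ _⟩

/-- It is a closed subset of the compact product of the input sets, so the terminal set need only be
closed. -/
theorem isCompact_localSet (hD : D.Standing) (i : Fin M) (x : Fin (n i) → ℝ) :
    IsCompact (D.localSet i x) := by
  have hU : IsCompact (Set.univ.pi fun _ : Fin N => D.U i) :=
    isCompact_univ_pi fun _ => (IsPolytope.isCompact (hD.polytope_U i)).1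
  refine hU.of_isClosed_subset ?_ fun u hu l _ => (hu.1 l).2
  have hX : IsClosed (D.X i) := (IsPolytope.isCompact (hD.polytope_X i)).1.isClosed
  have hUc : IsClosed (D.U i) := (IsPolytope.isCompact (hD.polytope_U i)).1.isClosed
  have h1 : D.localSet i x = (⋂ l : Fin N, ((fun u => D.pred i x u l.castSucc) ⁻¹' D.X i
      ∩ (fun u : Fin N → Fin (m i) → ℝ => u l) ⁻¹' D.U i))
      ∩ (fun u => D.pred i x u (Fin.last N)) ⁻¹' D.Xf i := by
    ext u
    simp [localSet]
  rw [h1]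
  exact (isClosed_iInter fun l => (hX.preimage (D.continuous_pred i x _)).inter
    (hUc.preimage (continuous_apply l))).inter ((hD.closed_Xf i).preimage (D.continuous_pred i x _))

theorem convex_localSet (hD : D.Standing) (i : Fin M) (x : Fin (n i) → ℝ) :
    Convex ℝ (D.localSet i x) := by
  intro u hu w hw a b ha hb hab
  simp only [localSet, Set.mem_ofPred_eq, D.pred_affine i x u w hab, Pi.add_apply, Pi.smul_apply]
  exact ⟨fun l => ⟨(IsPolytope.isCompact (hD.polytope_X i)).2 (hu.1 l).1 (hw.1 l).1 ha hb hab,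
    (IsPolytope.isCompact (hD.polytope_U i)).2 (hu.1 l).2 (hw.1 l).2 ha hb hab⟩,
    hD.convex_Xf i hu.2 hw.2 ha hb hab⟩

/-- The local Lagrangian. -/
noncomputable def localLagrangian (D : Data M N p n m) (i : Fin M) (x : Fin (n i) → ℝ)
    (v : Mult N p) (w : Fin N → Fin (m i) → ℝ) : ℝ :=
  D.J i x w + inner ℝ v (D.g i x w)

/-- Quadratic growth of the local Lagrangian around its minimizer over the local constraints. -/
theorem exists_quadratic_growth (hD : D.Standing) (i : Fin M) (x : Fin (n i) → ℝ) :
    ∃ r : ℝ, 0 < r ∧ ∀ v w₀ w, IsArgmin (D.localLagrangian i x v) (D.localSet i x) w₀ →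
      w ∈ D.localSet i x →
      D.localLagrangian i x v w₀ + r * ‖w - w₀‖ ^ 2 ≤ D.localLagrangian i x v w := by
  obtain ⟨r, hr, hR⟩ := exists_mul_norm_sq_le_quad (hD.posDef_R i)
  -- Minimality is tested at the midpoint; doubling the defect `1/4` gives `r / 2`. The multiplier
  -- term is affine in the inputs, so the modulus is uniform in `v`.
  refine ⟨r / 2, by positivity, fun v w₀ w h₀ hw => ?_⟩
  have hhalf : (1 / 2 : ℝ) + 1 / 2 = 1 := by norm_num
  have h1 : D.localLagrangian i x v w₀
      ≤ D.localLagrangian i x v ((1 / 2 : ℝ) • w + (1 / 2 : ℝ) • w₀) :=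
    h₀.2 (convex_localSet hD i x hw h₀.1 (by norm_num) (by norm_num) hhalf)
  have h2 := J_midpoint_le hD i x w w₀
  have h3 : r * ‖w - w₀‖ ^ 2 ≤ ∑ l, quad (D.R i) (w l - w₀ l) := by
    have h4 : ∀ l, r * ‖w l - w₀ l‖ ^ 2 ≤ ∑ l, quad (D.R i) (w l - w₀ l) := fun l =>
      (hR _).trans (Finset.single_le_sum (f := fun l => quad (D.R i) (w l - w₀ l))
        (fun l _ => quad_nonneg (hD.posDef_R i) _) (Finset.mem_univ l))
    have h5 : 0 ≤ ∑ l, quad (D.R i) (w l - w₀ l) :=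
      Finset.sum_nonneg fun l _ => quad_nonneg (hD.posDef_R i) _
    rw [← le_div_iff₀' hr]
    refine (Real.le_sqrt (norm_nonneg _) (by positivity)).1 ?_
    refine (pi_norm_le_iff_of_nonneg (Real.sqrt_nonneg _)).2 fun l => ?_
    refine Real.le_sqrt_of_sq_le ?_
    rw [le_div_iff₀' hr]
    exact h4 l
  simp only [localLagrangian, D.g_affine i x w w₀ hhalf, inner_add_right,
    real_inner_smul_right] at h1 ⊢
  linarith

theorem continuous_localLagrangian (D : Data M N p n m) (i : Fin M) (x : Fin (n i) → ℝ)
    (v : Mult N p) : Continuous (D.localLagrangian i x v) :=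
  (D.continuous_J i x).add (continuous_const.inner (D.continuous_g i x))

theorem exists_isArgmin_localLagrangian (hD : D.Standing) (i : Fin M) (x : Fin (n i) → ℝ)
    (hne : (D.localSet i x).Nonempty) (v : Mult N p) :
    ∃ w, IsArgmin (D.localLagrangian i x v) (D.localSet i x) w := by
  obtain ⟨w, hw, hmin⟩ := (isCompact_localSet hD i x).exists_isMinOn hne
    (D.continuous_localLagrangian i x v).continuousOn
  exact ⟨w, hw, hmin⟩

theorem exists_norm_g_le (hD : D.Standing) (x : States n) :
    ∃ C : ℝ, ∀ i, ∀ w ∈ D.localSet i (x i), ‖D.g i (x i) w‖ ≤ C := by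
  have h : ∀ i, ∃ C : ℝ, ∀ w ∈ D.localSet i (x i), ‖D.g i (x i) w‖ ≤ C := fun i =>
    (isCompact_localSet hD i (x i)).exists_bound_of_continuousOn (D.continuous_g i _).continuousOn
  choose C hC using h
  obtain ⟨C', hC'⟩ := (Set.finite_range C).bddAbove
  exact ⟨C', fun i w hw => (hC i w hw).trans (hC' ⟨i, rfl⟩)⟩

theorem lagrangian_eq_sum (hM : 0 < M) (D : Data M N p n m) (x : States n) (u : Inputs N m)
    (v : Mult N p) : D.lagrangian x u v = ∑ i, D.localLagrangian i (x i) v (u i) := by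
  have : (M : ℝ) ≠ 0 := by positivity
  simp only [lagrangian, localLagrangian, g, Finset.sum_add_distrib, ← inner_sum,
    Finset.sum_sub_distrib, Finset.sum_const, Finset.card_univ, Fintype.card_fin,
    ← Nat.cast_smul_eq_nsmul ℝ, smul_smul]
  rw [mul_one_div_cancel this, one_smul]

theorem sum_g (hM : 0 < M) (D : Data M N p n m) (x : States n) (u : Inputs N m) :
    ∑ i, D.g i (x i) (u i) = (∑ i, D.f i (x i) (u i)) - D.b := by
  have : (M : ℝ) ≠ 0 := by positivity
  simp only [g, Finset.sum_sub_distrib, Finset.sum_const, Finset.card_univ, Fintype.card_fin,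
    ← Nat.cast_smul_eq_nsmul ℝ, smul_smul]
  rw [mul_one_div_cancel this, one_smul]

end Data


/-! ### Projection on the orthant -/

section Projection

variable {N p : ℕ}

/-- The coordinatewise positive part. -/
noncomputable def posPart (v : Mult N p) : Mult N p := WithLp.toLp 2 fun a => max (v a) 0

theorem continuous_posPart : Continuous (posPart : Mult N p → Mult N p) := by
  unfold posPart
  fun_prop

theorem posPart_mem (v : Mult N p) : posPart v ∈ orthant N p := fun _ => le_max_right _ _

/-- The obtuse angle inequality for the positive part holds coordinate by coordinate and leaves no
room for another minimizer. -/
theorem IsProjOn.eq_posPart {v w : Mult N p} (h : IsProjOn (orthant N p) v w) : w = posPart v := by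
  have h1 : ‖w - v‖ ^ 2 ≤ ‖posPart v - v‖ ^ 2 := by
    have : ‖w - v‖ ≤ ‖posPart v - v‖ := h.2 (posPart_mem v)
    gcongr
  have h2 : ‖posPart v - v‖ ^ 2 + ‖w - posPart v‖ ^ 2 ≤ ‖w - v‖ ^ 2 := by
    simp only [EuclideanSpace.real_norm_sq_eq, ← Finset.sum_add_distrib]
    refine Finset.sum_le_sum fun a _ => ?_
    have ha : 0 ≤ w a := h.1 a
    simp only [PiLp.sub_apply, posPart]
    rcases le_total (v a) 0 with hv | hv
    · rw [max_eq_right hv]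
      nlinarith
    · rw [max_eq_left hv]
      nlinarith
  have h3 : ‖w - posPart v‖ ^ 2 = 0 := le_antisymm (by linarith) (sq_nonneg _)
  exact sub_eq_zero.1 (norm_eq_zero.1 (pow_eq_zero_iff two_ne_zero |>.1 h3))

theorem norm_posPart_sub_le {v s : Mult N p} (hs : s ∈ orthant N p) :
    ‖posPart v - s‖ ≤ ‖v - s‖ := by
  refine le_of_sq_le_sq ?_ (norm_nonneg _)
  simp only [EuclideanSpace.real_norm_sq_eq]
  refine Finset.sum_le_sum fun a _ => ?_
  have ha : 0 ≤ s a := hs a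
  simp only [PiLp.sub_apply, posPart]
  rcases le_total (v a) 0 with hv | hv
  · rw [max_eq_right hv]
    nlinarith
  · rw [max_eq_left hv]

theorem isClosed_orthant : IsClosed (orthant N p) := by
  have : orthant N p = ⋂ a, {v : Mult N p | 0 ≤ v a} := by
    ext v
    simp [orthant]
  rw [this]
  exact isClosed_iInter fun a => isClosed_le continuous_const (by fun_prop)

theorem convex_orthant : Convex ℝ (orthant N p) := by
  intro v hv w hw a b ha hb _ c
  have h1 : 0 ≤ v c := hv c
  have h2 : 0 ≤ w c := hw c
  simp only [PiLp.add_apply, PiLp.smul_apply, smul_eq_mul]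
  positivity

theorem inner_nonpos_of_mem_orthant {v w : Mult N p} (hv : v ∈ orthant N p) (hw : ∀ a, w a ≤ 0) :
    inner ℝ v w ≤ 0 := by
  rw [PiLp.inner_apply]
  refine Finset.sum_nonpos fun a _ => ?_
  have := hv a
  simpa using mul_nonpos_of_nonpos_of_nonneg (hw a) this

end Projection

/-! ### Responses, optimality conditions and the residual -/

namespace Data

variable {M N p : ℕ} {n m : Fin M → ℕ} {D : Data M N p n m}

/-- `R i v` minimizes the local Lagrangian at the multiplier `v`, which grows quadratically, with
modulus `r i`, away from `R i v`; the constraint functions are bounded by `C`. -/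
structure IsResponse (D : Data M N p n m) (x : States n)
    (R : ∀ i, Mult N p → Fin N → Fin (m i) → ℝ) (r : Fin M → ℝ) (C : ℝ) : Prop where
  mem : ∀ i v, R i v ∈ D.localSet i (x i)
  pos : ∀ i, 0 < r i
  growth : ∀ i v w₀ w, IsArgmin (D.localLagrangian i (x i) v) (D.localSet i (x i)) w₀ →
    w ∈ D.localSet i (x i) →
      D.localLagrangian i (x i) v w₀ + r i * ‖w - w₀‖ ^ 2 ≤ D.localLagrangian i (x i) v w
  isArgmin : ∀ i v, IsArgmin (D.localLagrangian i (x i) v) (D.localSet i (x i)) (R i v)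
  bound : ∀ i, ∀ w ∈ D.localSet i (x i), ‖D.g i (x i) w‖ ≤ C

theorem exists_isResponse (hD : D.Standing) (x : States n)
    (hne : (D.localSets x).Nonempty) : ∃ R r C, D.IsResponse x R r C := by
  obtain ⟨u, hu⟩ := hne
  choose R hR using fun i => exists_isArgmin_localLagrangian hD i (x i) ⟨u i, hu i⟩
  choose r hr hgrow using fun i => exists_quadratic_growth hD i (x i)
  obtain ⟨C, hC⟩ := exists_norm_g_le hD x
  exact ⟨R, r, C, fun i v => (hR i v).1, hr, hgrow, hR, hC⟩

namespace IsResponse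

variable {x : States n} {R : ∀ i, Mult N p → Fin N → Fin (m i) → ℝ} {r : Fin M → ℝ} {C : ℝ}

theorem eq_of_isArgmin (h : D.IsResponse x R r C) {i : Fin M} {v : Mult N p}
    {w : Fin N → Fin (m i) → ℝ}
    (hw : IsArgmin (D.localLagrangian i (x i) v) (D.localSet i (x i)) w) : w = R i v := by
  have h1 := h.growth i v (R i v) w (h.isArgmin i v) hw.1
  have h2 : D.localLagrangian i (x i) v w ≤ D.localLagrangian i (x i) v (R i v) := hw.2 (h.mem i v)
  have h3 : r i * ‖w - R i v‖ ^ 2 ≤ 0 := by linarith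
  have h4 : ‖w - R i v‖ ^ 2 = 0 :=
    le_antisymm (nonpos_of_mul_nonpos_right h3 (h.pos i)) (sq_nonneg _)
  exact sub_eq_zero.1 (norm_eq_zero.1 (pow_eq_zero_iff two_ne_zero |>.1 h4))

/-- The constraint functions are strongly monotone along the responses. -/
theorem inner_sub_le (h : D.IsResponse x R r C) (i : Fin M) (v v' : Mult N p) :
    inner ℝ (v - v') (D.g i (x i) (R i v) - D.g i (x i) (R i v'))
      ≤ -(r i * ‖R i v - R i v'‖ ^ 2) := by
  -- Adding the two growth inequalities cancels the costs and gives the bound with `2 * r i`; one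
  -- copy is given away.
  have h1 := h.growth i v (R i v) (R i v') (h.isArgmin i v) (h.mem i v')
  have h2 := h.growth i v' (R i v') (R i v) (h.isArgmin i v') (h.mem i v)
  have h3 := mul_nonneg (h.pos i).le (sq_nonneg ‖R i v - R i v'‖)
  rw [norm_sub_rev] at h1
  simp only [localLagrangian, inner_sub_left, inner_sub_right] at *
  linarith

/-- Strong monotonicity and the bound on `g` give `r ‖R w - R v‖² ≤ 2C ‖w - v‖`, a Hölder estimate
of exponent one half. -/
theorem continuous (h : D.IsResponse x R r C) (i : Fin M) : Continuous (R i) := by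
  rw [continuous_iff_continuousAt]
  intro v
  rw [ContinuousAt, tendsto_iff_norm_sub_tendsto_zero]
  have h1 : ∀ w, ‖R i w - R i v‖ ^ 2 ≤ 2 * C / r i * ‖w - v‖ := by
    intro w
    have h2 := h.inner_sub_le i w v
    have h3 : -inner ℝ (w - v) (D.g i (x i) (R i w) - D.g i (x i) (R i v))
        ≤ ‖w - v‖ * (C + C) := by
      rw [← inner_neg_left, ← norm_neg (w - v)]
      refine (real_inner_le_norm _ _).trans ?_
      gcongr
      exact (norm_sub_le _ _).trans (add_le_add (h.bound i _ (h.mem i _)) (h.bound i _ (h.mem i _)))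
    rw [div_mul_eq_mul_div, le_div_iff₀ (h.pos i)]
    linarith
  have h4 : Tendsto (fun w => 2 * C / r i * ‖w - v‖) (𝓝 v) (𝓝 0) := by
    have : Continuous fun w : Mult N p => 2 * C / r i * ‖w - v‖ := by fun_prop
    simpa using this.tendsto v
  have h5 := (squeeze_zero (fun w => sq_nonneg _) h1 h4).sqrt
  simpa [Real.sqrt_sq (norm_nonneg _)] using h5

theorem lagrangian_le (hM : 0 < M) (h : D.IsResponse x R r C) (v : Mult N p) {u : Inputs N m}
    (hu : u ∈ D.localSets x) : D.lagrangian x (fun i => R i v) v ≤ D.lagrangian x u v := by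
  simp only [lagrangian_eq_sum hM]
  exact Finset.sum_le_sum fun i _ => (h.isArgmin i v).2 (hu i)

theorem dualFun_eq (hM : 0 < M) (h : D.IsResponse x R r C) (v : Mult N p) :
    D.dualFun x v = D.lagrangian x (fun i => R i v) v := by
  refine IsLeast.csInf_eq ⟨⟨_, fun i => h.mem i v, rfl⟩, ?_⟩
  rintro _ ⟨u, hu, rfl⟩
  exact h.lagrangian_le hM v hu

/-- The first order optimality condition of the dual problem. -/
theorem inner_sum_g_nonpos (hM : 0 < M) (h : D.IsResponse x R r C) {v d : Mult N p}
    (hv : D.IsDualOptimal x v) (hd : ∀ t ∈ Set.Ioo (0 : ℝ) 1, v + t • d ∈ orthant N p) :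
    inner ℝ d (∑ i, D.g i (x i) (R i v)) ≤ 0 := by
  have hc : Continuous fun t : ℝ => inner ℝ d (∑ i, D.g i (x i) (R i (v + t • d))) := by
    have := fun i => (D.continuous_g i (x i)).comp
      ((h.continuous i).comp (by fun_prop : Continuous fun t : ℝ => v + t • d))
    exact continuous_const.inner (continuous_finsetSum _ fun i _ => this i)
  have ht : Tendsto (fun t : ℝ => inner ℝ d (∑ i, D.g i (x i) (R i (v + t • d)))) (𝓝[>] 0)
      (𝓝 (inner ℝ d (∑ i, D.g i (x i) (R i v)))) := by
    simpa using (hc.tendsto 0).mono_left nhdsWithin_le_nhds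
  refine le_of_tendsto ht ?_
  filter_upwards [Ioo_mem_nhdsGT (zero_lt_one' ℝ)] with t ht
  -- The dual function is not differentiated: the response at `v + t • d` is a competitor at `v`,
  -- and the two Lagrangian values differ by `t` times the inner product. Then `t → 0` by continuity
  -- of the responses.
  have h1 : D.dualFun x (v + t • d) ≤ D.dualFun x v := hv.2 (hd t ht)
  rw [h.dualFun_eq hM, h.dualFun_eq hM] at h1
  have h2 := h.lagrangian_le hM v (u := fun i => R i (v + t • d)) fun i => h.mem i _
  rw [sum_g hM D x fun i => R i (v + t • d)]
  simp only [lagrangian, inner_add_left, real_inner_smul_left] at h1 h2 ⊢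
  have h3 : t * inner ℝ d ((∑ i, D.f i (x i) (R i (v + t • d))) - D.b) ≤ 0 := by
    linarith
  exact nonpos_of_mul_nonpos_right h3 ht.1

theorem inner_sum_g_nonpos_of_feasible (hM : 0 < M) {v : Mult N p} (hv : v ∈ orthant N p)
    {u : Inputs N m} (hu : u ∈ D.feasible x) : inner ℝ v (∑ i, D.g i (x i) (u i)) ≤ 0 := by
  refine inner_nonpos_of_mem_orthant hv fun a => ?_
  rw [sum_g hM, PiLp.sub_apply]
  linarith [hu.2 a]

/-- A dual optimal multiplier and the primal optimal input satisfy the KKT conditions. -/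
theorem kkt (hM : 0 < M) (h : D.IsResponse x R r C) {v : Mult N p} (hv : D.IsDualOptimal x v)
    {u : Inputs N m} (hu : D.IsPrimalOptimal x u) :
    (∀ i, R i v = u i) ∧ inner ℝ v (∑ i, D.g i (x i) (u i)) = 0 := by
  have hd : ∀ a, (∑ i, D.g i (x i) (R i v)) a ≤ 0 := by
    intro a
    -- Increasing one coordinate gives the corresponding global constraint.
    have h1 := h.inner_sum_g_nonpos hM hv (d := EuclideanSpace.single a 1) fun t ht c => by
      have h2 : 0 ≤ v c := hv.1 c
      have h3 := ht.1.le
      simp only [PiLp.add_apply, PiLp.smul_apply, PiLp.single_apply, smul_eq_mul]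
      split_ifs <;> linarith
    simpa [EuclideanSpace.inner_single_left] using h1
  have hcs : inner ℝ v (∑ i, D.g i (x i) (R i v)) = 0 := by
    refine le_antisymm (inner_nonpos_of_mem_orthant hv.1 hd) ?_
    -- Shrinking `v` stays in the orthant and gives the missing half of complementary slackness.
    have h1 := h.inner_sum_g_nonpos hM hv (d := -v) fun t ht c => by
      have h2 : 0 ≤ v c := hv.1 c
      have h3 := ht.2
      simp only [PiLp.add_apply, PiLp.smul_apply, PiLp.neg_apply, smul_eq_mul]
      nlinarith
    rw [inner_neg_left] at h1
    linarith
  have hfeas : (fun i => R i v) ∈ D.feasible x := by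
    refine ⟨fun i => h.mem i v, fun a => ?_⟩
    have h1 := hd a
    rw [sum_g hM D x fun i => R i v, PiLp.sub_apply] at h1
    linarith
  have hopt : ∑ i, D.J i (x i) (u i) ≤ ∑ i, D.J i (x i) (R i v) := hu.2 hfeas
  have hu0 : inner ℝ v (∑ i, D.g i (x i) (u i)) ≤ 0 :=
    inner_sum_g_nonpos_of_feasible hM hv.1 hu.1
  -- The responses are feasible, so `u` costs no more than they do, while growth says that it costs
  -- more by `r i * ‖u i - R i v‖ ^ 2` in total. All these squares vanish.
  have hgrow := Finset.sum_le_sum fun i (_ : i ∈ Finset.univ) =>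
    h.growth i v (R i v) (u i) (h.isArgmin i v) (hu.1.1 i)
  simp only [localLagrangian, Finset.sum_add_distrib, ← inner_sum, hcs] at hgrow
  have h0 : ∀ i ∈ Finset.univ, 0 ≤ r i * ‖u i - R i v‖ ^ 2 := fun i _ =>
    mul_nonneg (h.pos i).le (sq_nonneg _)
  have hz : ∑ i, r i * ‖u i - R i v‖ ^ 2 = 0 := le_antisymm (by linarith) (Finset.sum_nonneg h0)
  have heq : ∀ i, R i v = u i := by
    intro i
    have h1 := (Finset.sum_eq_zero_iff_of_nonneg h0).1 hz i (Finset.mem_univ i)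
    have h2 := (mul_eq_zero.1 h1).resolve_left (h.pos i).ne'
    exact (sub_eq_zero.1 (norm_eq_zero.1 (pow_eq_zero_iff two_ne_zero |>.1 h2))).symm
  refine ⟨heq, ?_⟩
  simpa only [heq] using hcs

/-- The optimality residual of a family of local multipliers. -/
noncomputable def residual (D : Data M N p n m) (x : States n)
    (R : ∀ i, Mult N p → Fin N → Fin (m i) → ℝ) (r : Fin M → ℝ) (u : Inputs N m)
    (w : Fin M → Mult N p) : ℝ :=
  (∑ i, r i * ‖R i (w i) - u i‖ ^ 2) - inner ℝ (average w) (∑ i, D.g i (x i) (u i))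

theorem continuous_residual (h : D.IsResponse x R r C) (u : Inputs N m) :
    Continuous (residual D x R r u) := by
  have := h.continuous
  unfold residual
  fun_prop

theorem average_mem (hM : 0 < M) {w : Fin M → Mult N p} (hw : ∀ i, w i ∈ orthant N p) :
    average w ∈ orthant N p := by
  simp only [average, Finset.smul_sum]
  refine convex_orthant.sum_mem (fun i _ => by positivity) ?_ fun i _ => hw i
  have : (M : ℝ) ≠ 0 := by positivity
  simp [this]

theorem residual_nonneg (hM : 0 < M) (h : D.IsResponse x R r C) {u : Inputs N m}
    (hu : u ∈ D.feasible x) {w : Fin M → Mult N p} (hw : ∀ i, w i ∈ orthant N p) :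
    0 ≤ residual D x R r u w := by
  have h1 := inner_sum_g_nonpos_of_feasible hM (average_mem hM hw) hu
  have h2 : 0 ≤ ∑ i, r i * ‖R i (w i) - u i‖ ^ 2 :=
    Finset.sum_nonneg fun i _ => mul_nonneg (h.pos i).le (sq_nonneg _)
  unfold residual
  linarith

theorem residual_const_eq_zero_iff (hM : 0 < M) (h : D.IsResponse x R r C) {u : Inputs N m}
    (hu : u ∈ D.feasible x) {s : Mult N p} (hs : s ∈ orthant N p) :
    residual D x R r u (fun _ => s) = 0 ↔
      (∀ i, R i s = u i) ∧ inner ℝ s (∑ i, D.g i (x i) (u i)) = 0 := by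
  have h1 := inner_sum_g_nonpos_of_feasible hM hs hu
  have h0 : ∀ i ∈ Finset.univ, 0 ≤ r i * ‖R i s - u i‖ ^ 2 := fun i _ =>
    mul_nonneg (h.pos i).le (sq_nonneg _)
  have h2 := Finset.sum_nonneg h0
  simp only [residual, average_const hM]
  constructor
  · intro h3
    refine ⟨fun i => ?_, by linarith⟩
    have h4 := (Finset.sum_eq_zero_iff_of_nonneg h0).1 (by linarith) i (Finset.mem_univ i)
    have h5 := (mul_eq_zero.1 h4).resolve_left (h.pos i).ne'
    exact sub_eq_zero.1 (norm_eq_zero.1 (pow_eq_zero_iff two_ne_zero |>.1 h5))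
  · rintro ⟨h3, h4⟩
    simp [h3, h4]

/-- Monotonicity replaces each response by `u i` at the gain of a square. Splitting `w i - s` into
disagreement and average then leaves the slackness term of the residual, since the term with `s` is
zero; the individual `g_i` need not vanish, hence the error `C * ‖deviation w i‖`. -/
theorem sum_inner_le (hM : 0 < M) (h : D.IsResponse x R r C) {u : Inputs N m}
    (hu : u ∈ D.feasible x) {s : Mult N p} (hs : s ∈ orthant N p)
    (hz : residual D x R r u (fun _ => s) = 0) (w : Fin M → Mult N p) :
    ∑ i, inner ℝ (w i - s) (D.g i (x i) (R i (w i)))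
      ≤ -residual D x R r u w + C * ∑ i, ‖deviation w i‖ := by
  obtain ⟨hR, hcs⟩ := (residual_const_eq_zero_iff hM h hu hs).1 hz
  have hi : ∀ i, inner ℝ (w i - s) (D.g i (x i) (R i (w i))) ≤ -(r i * ‖R i (w i) - u i‖ ^ 2)
      + C * ‖deviation w i‖ + inner ℝ (average w - s) (D.g i (x i) (u i)) := by
    intro i
    have h1 := h.inner_sub_le i (w i) s
    rw [hR i] at h1
    have h2 : w i - s = deviation w i + (average w - s) := by
      simp only [deviation]
      abel
    have h3 : inner ℝ (deviation w i) (D.g i (x i) (u i)) ≤ ‖deviation w i‖ * C :=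
      (real_inner_le_norm _ _).trans (by gcongr; exact h.bound i _ (hu.1 i))
    have h4 : inner ℝ (w i - s) (D.g i (x i) (u i)) = inner ℝ (deviation w i) (D.g i (x i) (u i))
        + inner ℝ (average w - s) (D.g i (x i) (u i)) := by
      rw [h2, inner_add_left]
    rw [inner_sub_right] at h1
    linarith
  refine (Finset.sum_le_sum fun i _ => hi i).trans (le_of_eq ?_)
  simp only [Finset.sum_add_distrib, Finset.sum_neg_distrib, ← Finset.mul_sum, ← inner_sum]
  rw [residual, inner_sub_left, hcs]
  ring

end IsResponse

end Data


/-! ### The algorithm as a perturbed recursion -/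

section Execution

variable {M N p : ℕ} {n m : Fin M → ℕ} {D : Data M N p n m} {x : States n}
  {R : ∀ i, Mult N p → Fin N → Fin (m i) → ℝ} {r : Fin M → ℝ} {C : ℝ}
  {L : Matrix (Fin M) (Fin M) ℝ}

/-- The communication noise entering the multiplier update of subsystem `i`. -/
noncomputable def receivedNoise (L : Matrix (Fin M) (Fin M) ℝ) (χ : ℝ) (ζ : Fin M → Mult N p) (i : Fin M) :
    Mult N p :=
  χ • ∑ j ∈ neighbors L i, L i j • ζ j

/-- Off-diagonal entries outside the neighbourhood are zero, and the diagonal entry collects the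
terms `-L i j • v i`. -/
theorem IsInteraction.sum_neighbors (hL : IsInteraction L) (i : Fin M) (v ζ : Fin M → Mult N p) :
    ∑ j ∈ neighbors L i, L i j • ((v j + ζ j) - v i)
      = ∑ j, L i j • v j + ∑ j ∈ neighbors L i, L i j • ζ j := by
  have h1 : ∑ j ∈ neighbors L i, L i j • v j + L i i • v i = ∑ j, L i j • v j := by
    rw [← Finset.sum_erase_add _ _ (Finset.mem_univ i)]
    congr 1
    refine Finset.sum_subset (fun j hj => ?_) fun j hj hj' => ?_
    · simp only [neighbors, Finset.mem_filter] at hj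
      simp [hj.2.1]
    · have hji : j ≠ i := (Finset.mem_erase.1 hj).1
      have h0 : L i j = 0 := by
        by_contra hne
        refine hj' (Finset.mem_filter.2 ⟨Finset.mem_univ _, hji, ?_⟩)
        exact lt_of_le_of_ne (hL.nonneg i j hji.symm) (Ne.symm hne)
      simp [h0]
  rw [← h1, hL.diag i, neg_smul, Finset.sum_smul]
  simp only [smul_sub, smul_add, Finset.sum_sub_distrib, Finset.sum_add_distrib]
  abel

/-- The multiplier update of an execution in terms of the responses and the received noise. -/
theorem IsExecution.succ_eq (hL : IsInteraction L) (hR : D.IsResponse x R r C) {χ γ : ℕ → ℝ}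
    {lam0 : Fin M → Mult N p} {ζ lam : ℕ → Fin M → Mult N p} {u : ℕ → Inputs N m}
    (h : IsExecution D x L χ γ lam0 ζ lam u) (k : ℕ) (i : Fin M) :
    lam (k + 1) i = posPart (lam k i + χ k • (∑ j, L i j • lam k j)
      + γ k • D.g i (x i) (R i (lam k i)) + receivedNoise L (χ k) (ζ k) i) := by
  have h1 : u (k + 1) i = R i (lam k i) := hR.eq_of_isArgmin (h.step_u k i)
  have h2 := (h.step_lam k i).eq_posPart
  rw [h1, hL.sum_neighbors] at h2
  rw [h2, receivedNoise]
  congr 1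
  rw [smul_add]
  abel

theorem norm_sq_sum_smul_le {s : Finset (Fin M)} (a : Fin M → ℝ) (ζ : Fin M → Mult N p) :
    ‖∑ j ∈ s, a j • ζ j‖ ^ 2 ≤ (∑ j, a j ^ 2) * ∑ j, ‖ζ j‖ ^ 2 := by
  calc ‖∑ j ∈ s, a j • ζ j‖ ^ 2 ≤ (∑ j ∈ s, |a j| * ‖ζ j‖) ^ 2 := by
        gcongr
        refine (norm_sum_le _ _).trans (le_of_eq ?_)
        simp [norm_smul]
    _ ≤ (∑ j ∈ s, |a j| ^ 2) * ∑ j ∈ s, ‖ζ j‖ ^ 2 := Finset.sum_mul_sq_le_sq_mul_sq _ _ _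
    _ ≤ (∑ j, a j ^ 2) * ∑ j, ‖ζ j‖ ^ 2 := by
        simp only [sq_abs]
        gcongr <;> exact Finset.subset_univ _

end Execution

/-! ### Moments and measurability of noise and multipliers -/

section Noise

variable {M N p : ℕ} {L : Matrix (Fin M) (Fin M) ℝ} {Ω : Type*} {mΩ : MeasurableSpace Ω}
  {μ : Measure Ω} {χ : ℕ → ℝ} {σ : ℕ → Fin M → ℝ} {ζ lam : ℕ → Fin M → Ω → Mult N p}

theorem memLp_receivedNoise (hζ : IsNoise μ χ σ ζ lam) (k : ℕ) (i : Fin M) :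
    MemLp (fun ω => receivedNoise L (χ k) (fun j => ζ k j ω) i) 2 μ :=
  (memLp_finsetSum _ fun j _ => (hζ.memLp k j).const_smul (L i j)).const_smul (χ k)

theorem condExp_receivedNoise [IsProbabilityMeasure μ] (hζ : IsNoise μ χ σ ζ lam) (k : ℕ)
    (i : Fin M) :
    μ[fun ω => receivedNoise L (χ k) (fun j => ζ k j ω) i | history lam k] =ᵐ[μ] 0 := by
  have h1 := condExp_smul (μ := μ) (χ k) (∑ j ∈ neighbors L i, L i j • ζ k j) (history lam k)
  have h2 := condExp_finsetSum (μ := μ) (s := neighbors L i) (f := fun j => L i j • ζ k j)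
    (fun j _ => ((hζ.memLp k j).integrable one_le_two).smul _) (history lam k)
  have h3 : ∀ᵐ ω ∂μ, ∀ j, (μ[L i j • ζ k j | history lam k]) ω = 0 := by
    rw [ae_all_iff]
    intro j
    filter_upwards [condExp_smul (μ := μ) (L i j) (ζ k j) (history lam k), hζ.mean k j]
      with ω h4 h5
    rw [h4, Pi.smul_apply, h5, Pi.zero_apply, smul_zero]
  have h6 : (fun ω => receivedNoise L (χ k) (fun j => ζ k j ω) i)
      = χ k • ∑ j ∈ neighbors L i, L i j • ζ k j := by
    ext ω : 1
    simp [receivedNoise]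
  rw [h6]
  filter_upwards [h1, h2, h3] with ω h1 h2 h3
  rw [h1, Pi.smul_apply, h2, Finset.sum_apply]
  simp [h3]

/-- Cauchy–Schwarz bounds the received noise by the squared entries of `L` times the total squared
noise, so independence across subsystems plays no role. -/
theorem condExp_norm_receivedNoise_sq_le [IsProbabilityMeasure μ] (hζ : IsNoise μ χ σ ζ lam)
    (k : ℕ) (i : Fin M) :
    μ[fun ω => ‖receivedNoise L (χ k) (fun j => ζ k j ω) i‖ ^ 2 | history lam k] ≤ᵐ[μ]
      fun _ => (∑ i, ∑ j, L i j ^ 2) * M * (χ k ^ 2 * ⨆ i, σ k i ^ 2) := by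
  set A := ∑ i, ∑ j, L i j ^ 2
  have hA : ∑ j, L i j ^ 2 ≤ A := Finset.single_le_sum (f := fun i => ∑ j, L i j ^ 2)
    (fun i _ => Finset.sum_nonneg fun j _ => sq_nonneg _) (Finset.mem_univ i)
  have hA0 : 0 ≤ A := Finset.sum_nonneg fun i _ => Finset.sum_nonneg fun j _ => sq_nonneg _
  have hi : ∀ j, Integrable (fun ω => ‖ζ k j ω‖ ^ 2) μ := fun j =>
    (hζ.memLp k j).integrable_norm_pow two_ne_zero
  have h1 : μ[fun ω => ‖receivedNoise L (χ k) (fun j => ζ k j ω) i‖ ^ 2 | history lam k] ≤ᵐ[μ]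
      μ[(χ k ^ 2 * A) • ∑ j, fun ω => ‖ζ k j ω‖ ^ 2 | history lam k] := by
    refine condExp_mono ((memLp_receivedNoise hζ k i).integrable_norm_pow two_ne_zero)
      ((integrable_finsetSum' _ fun j _ => hi j).smul _) (ae_of_all _ fun ω => ?_)
    simp only [receivedNoise, norm_smul, mul_pow, Real.norm_eq_abs, sq_abs, Pi.smul_apply,
      Finset.sum_apply, smul_eq_mul, mul_assoc]
    have h2 := norm_sq_sum_smul_le (s := neighbors L i) (L i) fun j => ζ k j ω
    refine mul_le_mul_of_nonneg_left (h2.trans ?_) (sq_nonneg _)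
    exact mul_le_mul_of_nonneg_right hA (Finset.sum_nonneg fun j _ => sq_nonneg _)
  have h2 := condExp_smul (μ := μ) (χ k ^ 2 * A) (∑ j, fun ω => ‖ζ k j ω‖ ^ 2) (history lam k)
  have h3 := condExp_finsetSum (μ := μ) (s := Finset.univ) (f := fun j ω => ‖ζ k j ω‖ ^ 2)
    (fun j _ => hi j) (history lam k)
  have h4 := ae_all_iff.2 fun j => hζ.second k j
  filter_upwards [h1, h2, h3, h4] with ω h1 h2 h3 h4
  refine h1.trans ?_
  rw [h2, Pi.smul_apply, h3, Finset.sum_apply]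
  simp only [h4, smul_eq_mul]
  have h5 : ∑ j, σ k j ^ 2 ≤ M * ⨆ i, σ k i ^ 2 := by
    refine (Finset.sum_le_card_nsmul _ _ _ fun j _ =>
      le_ciSup (f := fun i => σ k i ^ 2) (Set.finite_range _).bddAbove j).trans ?_
    simp
  calc χ k ^ 2 * A * ∑ j, σ k j ^ 2 ≤ χ k ^ 2 * A * (M * ⨆ i, σ k i ^ 2) := by gcongr
    _ = _ := by ring

theorem memLp_of_step [IsProbabilityMeasure μ] (hζ : IsNoise μ χ σ ζ lam) {γ : ℕ → ℝ}
    {h : Fin M → Mult N p → Mult N p} {C : ℝ} {lam0 : Fin M → Mult N p}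
    (hh : ∀ i, Continuous (h i)) (hC : ∀ i v, ‖h i v‖ ≤ C) (hzero : ∀ i, lam 0 i = fun _ => lam0 i)
    (hsucc : ∀ k i, lam (k + 1) i = fun ω => posPart (lam k i ω + χ k • (∑ j, L i j • lam k j ω)
      + γ k • h i (lam k i ω) + receivedNoise L (χ k) (fun j => ζ k j ω) i)) (k : ℕ) (i : Fin M) :
    MemLp (lam k i) 2 μ := by
  induction k generalizing i with
  | zero =>
    rw [hzero]
    exact memLp_const _
  | succ k ih =>
    have h1 : MemLp (fun ω => h i (lam k i ω)) 2 μ :=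
      MemLp.of_bound ((hh i).comp_aestronglyMeasurable (ih i).1) C (ae_of_all _ fun ω => hC i _)
    have h2 : MemLp (fun ω => lam k i ω + χ k • (∑ j, L i j • lam k j ω)
        + γ k • h i (lam k i ω) + receivedNoise L (χ k) (fun j => ζ k j ω) i) 2 μ :=
      (((ih i).add ((memLp_finsetSum Finset.univ fun j _ =>
        (ih j).const_smul (L i j)).const_smul (χ k))).add (h1.const_smul (γ k))).add
          (memLp_receivedNoise (L := L) hζ k i)
    rw [hsucc]
    refine h2.mono (continuous_posPart.comp_aestronglyMeasurable h2.1) (ae_of_all _ fun ω => ?_)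
    -- The orthant contains zero, so projecting does not increase the norm.
    simpa only [sub_zero] using norm_posPart_sub_le (v := lam k i ω
      + χ k • (∑ j, L i j • lam k j ω) + γ k • h i (lam k i ω)
      + receivedNoise L (χ k) (fun j => ζ k j ω) i) (s := 0) fun _ => le_rfl

theorem measurable_of_step (hζ : IsNoise μ χ σ ζ lam) {γ : ℕ → ℝ}
    {h : Fin M → Mult N p → Mult N p} {lam0 : Fin M → Mult N p}
    (hh : ∀ i, Continuous (h i)) (hzero : ∀ i, lam 0 i = fun _ => lam0 i)
    (hsucc : ∀ k i, lam (k + 1) i = fun ω => posPart (lam k i ω + χ k • (∑ j, L i j • lam k j ω)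
      + γ k • h i (lam k i ω) + receivedNoise L (χ k) (fun j => ζ k j ω) i)) (k : ℕ) (i : Fin M) :
    Measurable (lam k i) := by
  induction k generalizing i with
  | zero =>
    rw [hzero]
    exact measurable_const
  | succ k ih =>
    rw [hsucc]
    refine continuous_posPart.measurable.comp ?_
    have h1 : Measurable fun ω => h i (lam k i ω) := (hh i).measurable.comp (ih i)
    have h2 := hζ.measurable k
    unfold receivedNoise
    fun_prop

/-- The filtration generated by the multipliers. -/
def historyFiltration (hlam : ∀ k i, Measurable (lam k i)) : Filtration ℕ mΩ where
  seq := history lam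
  mono' := fun _ _ hkl => iSup₂_le fun l hl => le_iSup₂_of_le l (hl.trans hkl) le_rfl
  le' := fun _ => iSup₂_le fun l _ => iSup_le fun j => (hlam l j).comap_le

theorem measurable_history (k : ℕ) (i : Fin M) : Measurable[history lam k] (lam k i) :=
  (comap_measurable (lam k i)).mono
    (le_iSup₂_of_le (f := fun l (_ : l ≤ k) => ⨆ j, MeasurableSpace.comap (lam l j) inferInstance)
      k le_rfl (le_iSup (fun j => MeasurableSpace.comap (lam k j) inferInstance) i)) le_rfl

theorem stronglyMeasurable_of_measurable {m : MeasurableSpace Ω} {f : Ω → Mult N p}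
    (hf : Measurable[m] f) : StronglyMeasurable[m] f :=
  hf.stronglyMeasurable

end Noise

end DMPC

/-! ### Convergence of the algorithm -/

theorem theorem2 {M N p : ℕ} (hM : 0 < M) (hN : 0 < N) {n m : Fin M → ℕ}
    (D : DMPC.Data M N p n m) (hD : D.Standing) (x : DMPC.States n)
    (L : Matrix (Fin M) (Fin M) ℝ) (hL : DMPC.IsInteraction L)
    {Ω : Type*} [MeasurableSpace Ω] (μ : Measure Ω) [IsProbabilityMeasure μ]
    (χ γ : ℕ → ℝ) (σ : ℕ → Fin M → ℝ) (lam0 : Fin M → DMPC.Mult N p)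
    (ζ lam : ℕ → Fin M → Ω → DMPC.Mult N p) (u : ℕ → Ω → DMPC.Inputs N m)
    (hlam0 : ∀ i, lam0 i ∈ DMPC.orthant N p)
    (hexec : ∀ ω, DMPC.IsExecution D x L χ γ lam0
      (fun k i => ζ k i ω) (fun k i => lam k i ω) (fun k => u k ω))
    (hζ : DMPC.IsNoise μ χ σ ζ lam)
    (hχ : ∀ k, 0 < χ k) (hγ : ∀ k, 0 ≤ γ k)
    (hχ1 : Tendsto (fun K => ∑ k ∈ Finset.range K, χ k) atTop atTop)
    (hχ2 : Summable fun k => χ k ^ 2)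
    (hγ1 : Tendsto (fun K => ∑ k ∈ Finset.range K, γ k) atTop atTop)
    (hγχ : Summable fun k => γ k ^ 2 / χ k)
    (ustar : DMPC.Inputs N m) (lamstar : DMPC.Mult N p)
    (hu : D.IsPrimalOptimal x ustar) (hlam : D.IsDualOptimal x lamstar) :
    ∀ᵐ ω ∂μ,
      Tendsto (fun k => D.lagrangian x ustar (DMPC.average fun i => lam k i ω)) atTop
        (𝓝 (D.lagrangian x ustar lamstar)) ∧
      Tendsto (fun k => D.lagrangian x (u k ω) lamstar) atTop
        (𝓝 (D.lagrangian x ustar lamstar)) := by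
  obtain ⟨R, r, C, hR⟩ := DMPC.Data.exists_isResponse hD x ⟨ustar, hu.1.1⟩
  obtain ⟨hRstar, hcs⟩ := hR.kkt hM hlam hu
  have hgR : ∀ i, Continuous fun v => D.g i (x i) (R i v) := fun i =>
    (D.continuous_g i (x i)).comp (hR.continuous i)
  have hsucc : ∀ k i, lam (k + 1) i = fun ω => DMPC.posPart (lam k i ω
      + χ k • (∑ j, L i j • lam k j ω) + γ k • D.g i (x i) (R i (lam k i ω))
      + DMPC.receivedNoise L (χ k) (fun j => ζ k j ω) i) := fun k i =>
    funext fun ω => (hexec ω).succ_eq hL hR k i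
  have hzero : ∀ i, lam 0 i = fun _ => lam0 i := fun i =>
    funext fun ω => congrFun (hexec ω).init_lam i
  have hK : ∀ k i ω, lam k i ω ∈ DMPC.orthant N p := by
    rintro (_ | k) i ω
    · rw [hzero]
      exact hlam0 i
    · rw [hsucc]
      exact DMPC.posPart_mem _
  have hgb : ∀ i v, ‖D.g i (x i) (R i v)‖ ≤ C := fun i v => hR.bound i _ (hR.mem i v)
  have hmem := DMPC.memLp_of_step hζ hgR hgb hzero hsucc
  have hmeas := DMPC.measurable_of_step hζ hgR hzero hsucc
  obtain ⟨k₀, hk₀⟩ : ∃ k₀, ∀ k, k₀ ≤ k → χ k ≤ 1 := by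
    obtain ⟨k₀, hk₀⟩ := eventually_atTop.1
      (hχ2.tendsto_atTop_zero.eventually_lt_const zero_lt_one)
    exact ⟨k₀, fun k hk => ((sq_lt_one_iff₀ (hχ k).le).1 (hk₀ k hk)).le⟩
  have hτ0 : ∀ k, 0 ≤ (∑ i, ∑ j, L i j ^ 2) * M * (χ k ^ 2 * ⨆ i, σ k i ^ 2) := fun k => by
    have h1 : 0 ≤ ⨆ i, σ k i ^ 2 := Real.iSup_nonneg fun i => sq_nonneg _
    positivity
  have hχs : ¬Summable χ := by
    rw [not_summable_iff_tendsto_nat_atTop_of_nonneg fun k => (hχ k).le]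
    exact hχ1
  have hγs : ¬Summable γ := by
    rw [not_summable_iff_tendsto_nat_atTop_of_nonneg hγ]
    exact hγ1
  have hmain := DMPC.ae_exists_tendsto_of_step_shift (μ := μ) hM hL
    (DMPC.historyFiltration hmeas) hχ hk₀ hγ hτ0 hχs hγs hγχ (hζ.summable.mul_left _) hgR hgb
    DMPC.isClosed_orthant DMPC.convex_orthant
    (fun k i => DMPC.stronglyMeasurable_of_measurable (DMPC.measurable_history k i))
    hmem hK (DMPC.memLp_receivedNoise hζ) (DMPC.condExp_receivedNoise hζ)
    (DMPC.condExp_norm_receivedNoise_sq_le hζ)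
    (fun k ω i s hs => by
      rw [hsucc]
      exact DMPC.norm_posPart_sub_le hs)
    (hR.continuous_residual ustar) (fun w => hR.residual_nonneg hM hu.1)
    ⟨lamstar, hlam.1, (hR.residual_const_eq_zero_iff hM hu.1 hlam.1).2 ⟨hRstar, hcs⟩⟩
    (fun s hs hz w _ => hR.sum_inner_le hM hu.1 hs hz w)
  filter_upwards [hmain] with ω ⟨s, hs, hz, hlim⟩
  obtain ⟨hRs, hcs'⟩ := (hR.residual_const_eq_zero_iff hM hu.1 hs).1 hz
  constructor
  · have h1 : Tendsto (fun k => DMPC.average fun i => lam k i ω) atTop (𝓝 s) := by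
      have h2 := (DMPC.continuous_average.tendsto fun _ : Fin M => s).comp
        (tendsto_pi_nhds.2 hlim)
      rwa [DMPC.average_const hM] at h2
    -- By complementary slackness both sides equal the optimal primal cost.
    have h3 : D.lagrangian x ustar lamstar = D.lagrangian x ustar s := by
      rw [DMPC.Data.sum_g hM] at hcs hcs'
      rw [DMPC.Data.lagrangian, DMPC.Data.lagrangian, hcs, hcs']
    have h4 : Continuous fun v => D.lagrangian x ustar v := by
      unfold DMPC.Data.lagrangian
      fun_prop
    rw [h3]
    exact (h4.tendsto s).comp h1
  -- The initial input is arbitrary; only from index one on are the inputs responses, to the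
  -- preceding multipliers.
  · rw [← tendsto_add_atTop_iff_nat 1]
    have h1 : ∀ k i, u (k + 1) ω i = R i (lam k i ω) := fun k i =>
      hR.eq_of_isArgmin ((hexec ω).step_u k i)
    have h2 : Tendsto (fun k => u (k + 1) ω) atTop (𝓝 ustar) := by
      rw [tendsto_pi_nhds]
      intro i
      simp only [h1]
      rw [← hRs i]
      exact ((hR.continuous i).tendsto s).comp (hlim i)
    have h4 : Continuous fun w => D.lagrangian x w lamstar := by
      have hJ := fun i => (D.continuous_J i (x i))
      have hf := fun i => (D.continuous_f i (x i))
      unfold DMPC.Data.lagrangian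
      fun_prop
    exact (h4.tendsto ustar).comp h2
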